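/- Let $X=(X_t)_{t\ge 0}$ be a spectrally negative Lévy process with $X_0=0$ on a probability space $(\Omega,\mathcal F,\mathbb P)$: it has stationary independent increments, right-continuous paths with left limits, no positive jumps, and its paths are not almost surely nonincreasing. Let $\overline X_t=\sup_{s\le t}X_s$ and $\underline X_t=\inf_{s\le t}X_s$. Let $r>0$, $a>b>0$, $p,\alpha\in\mathbb R$, and let $y,z\ge 0$ with $y<a$ or $z<b$. Define the drawdown and drawup processes started from $y$ and $z$ by $$D_t=(\overline X_t\vee y)-X_t,\qquad U_t=X_t-\bigl(\underline X_t\wedge(-z)\bigr),$$ and put (with $\inf\emptyset=\infty$ and $e^{-r\infty}=0$) $$\tau_D=\inf\{t\ge0:D_t\ge a\},\quad \tau_U=\inf\{t\ge0:U_t\ge b\},\quad \tau_x^+=\inf\{t\ge0:X_t\ge x\},\quad \tau_x^-=\inf\{t\ge0:X_t\le x\}.$$ Write $\tau_U^{0}=\inf\{t\ge 0: X_t-\underline X_t\wedge 0\ge b\}$ for the drawup time of a process started with drawup $0$, and write $\mathbb E[Y;A]=\mathbb E[Y\mathbf 1_A]$. The price of the drawdown contract with drawup contingency is $$k(y,z,p)=\mathbb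 E\Bigl[-\int_0^{\tau_D\wedge\tau_U}e^{-rt}p\,dt+\alpha e^{-r\tau_D}\mathbf 1_{(\tau_D\le\tau_U)}\Bigr].$$ Then the random variable inside this expectation is integrable and $$k(y,z,p)=\Bigl(\frac pr+\alpha\Bigr)\nu(y,z)+\frac pr\lambda(y,z)-\frac pr,$$ where $\nu(y,z)=\mathbb E[e^{-r\tau_D};\tau_D\le\tau_U]$ and $\lambda(y,z)=\mathbb E[e^{-r\tau_U};\tau_U<\tau_D]$. Moreover $\mathbb E[e^{-r\tau_U^0}]>0$, and $$\nu(y,z)=\mathbb E\bigl[e^{-r\tau^-_{y-a}};\tau^-_{y-a}<\tau^+_{b-z}\bigr]\mathbf 1_{(y+z\ge a)}+\mathbb E\bigl[e^{-r\tau_U};\ \overline X_{\tau_U}\vee y-\underline X_{\tau_U}\ge a,\ \underline X_{\tau_U}\le -z,\ \overline X_{\tau_U}\le b-z\bigr]\frac{\mathbf 1_{(y+z<a)}}{\mathbb E[e^{-r\tau_U^0}]},$$ $$\lambda(y,z)=\mathbb E\bigl[e^{-r\tau^+_{b-z}};\tau^+_{b-z}<\tau^-_{(y-a)\vee(-z)}\bigr]+\mathbb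 E\bigl[e^{-r\tau_U};\ \overline X_{\tau_U}\vee y-\underline X_{\tau_U}<a,\ \underline X_{\tau_U}\le -z\bigr].$$ -/

import Mathlib

open MeasureTheory ProbabilityTheory Filter Topology Set
open scoped NNReal ENNReal

noncomputable section

namespace Drawdown

variable {Ω : Type*}

/-- A spectrally negative Lévy process started at `0` (time axis `[0, ∞)`): independent and
stationary increments, almost surely right-continuous paths with left limits and no positive jumps,
and, as is part of the definition of "spectrally negative", paths that are not almost surely
nonincreasing (the process is not the negative of a subordinator). -/
structure IsSpectrallyNegativeLevy [MeasurableSpace Ω] (X : ℝ≥0 → Ω → ℝ) (P : Measure Ω) :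
    Prop where
  measurable : ∀ t, Measurable (X t)
  start_zero : ∀ᵐ ω ∂P, X 0 ω = 0
  indep_increments : HasIndepIncrements X P
  stationary_increments : ∀ s t : ℝ≥0,
    IdentDistrib (fun ω => X (s + t) ω - X s ω) (fun ω => X t ω - X 0 ω) P P
  right_continuous : ∀ᵐ ω ∂P, ∀ t : ℝ≥0, ContinuousWithinAt (fun s => X s ω) (Ici t) t
  /-- The left limit exists and the jump (value minus left limit) is nonpositive. -/
  left_limits_no_positive_jumps : ∀ᵐ ω ∂P, ∀ t : ℝ≥0, ∃ l : ℝ,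
    Tendsto (fun s => X s ω) (𝓝[<] t) (𝓝 l) ∧ X t ω ≤ l
  not_nonincreasing : ¬ ∀ᵐ ω ∂P, ∀ s t : ℝ≥0, s ≤ t → X t ω ≤ X s ω

/-- Running maximum `sup_{s ≤ t} X_s`. -/
def runMax (X : ℝ≥0 → Ω → ℝ) (t : ℝ≥0) (ω : Ω) : ℝ := ⨆ s : Iic t, X s ω

/-- Running minimum `inf_{s ≤ t} X_s`. -/
def runMin (X : ℝ≥0 → Ω → ℝ) (t : ℝ≥0) (ω : Ω) : ℝ := ⨅ s : Iic t, X s ω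

/-- Drawdown process with historical maximum `y`. -/
def drawdown (X : ℝ≥0 → Ω → ℝ) (y : ℝ) (t : ℝ≥0) (ω : Ω) : ℝ := max (runMax X t ω) y - X t ω

/-- Drawup process with historical minimum `-z`. -/
def drawup (X : ℝ≥0 → Ω → ℝ) (z : ℝ) (t : ℝ≥0) (ω : Ω) : ℝ := X t ω - min (runMin X t ω) (-z)

/-- First time (in `[0, ∞]`) at which the process is `≥ c`; it is `⊤` if there is none. -/
def timeAbove (Y : ℝ≥0 → Ω → ℝ) (c : ℝ) : Ω → WithTop ℝ≥0 := hittingAfter Y (Ici c) 0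

/-- First time (in `[0, ∞]`) at which the process is `≤ c`; it is `⊤` if there is none. -/
def timeBelow (Y : ℝ≥0 → Ω → ℝ) (c : ℝ) : Ω → WithTop ℝ≥0 := hittingAfter Y (Iic c) 0

/-- `e^{-rτ}`, with value `0` at `τ = ∞`. -/
def discount (r : ℝ) (τ : WithTop ℝ≥0) : ℝ :=
  if τ = ⊤ then 0 else Real.exp (-(r * ((τ.untopD 0 : ℝ≥0) : ℝ)))

/-- `E[e^{-rτ}; A]`. -/
def discountOn [MeasurableSpace Ω] (P : Measure Ω) (r : ℝ) (τ : Ω → WithTop ℝ≥0) (A : Set Ω) : ℝ :=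
  ∫ ω, A.indicator (fun ω => discount r (τ ω)) ω ∂P

/-- Time of the drawdown of size `a`, started from drawdown `y`. -/
def τD (X : ℝ≥0 → Ω → ℝ) (y a : ℝ) : Ω → WithTop ℝ≥0 := timeAbove (drawdown X y) a

/-- Time of the drawup of size `b`, started from drawup `z`. -/
def τU (X : ℝ≥0 → Ω → ℝ) (z b : ℝ) : Ω → WithTop ℝ≥0 := timeAbove (drawup X z) b

/-- Discounted cash flow of the contract: premium rate `p` until the drawdown of size `a` or the
drawup of size `b`, whichever comes first, and payment `α` at the drawdown time if the drawdown is
not preceded by the drawup. -/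
def payoff (X : ℝ≥0 → Ω → ℝ) (r a b p α y z : ℝ) (ω : Ω) : ℝ :=
  -(∫ t in {t : ℝ | 0 ≤ t ∧ (t.toNNReal : WithTop ℝ≥0) ≤ min (τD X y a ω) (τU X z b ω)},
      Real.exp (-(r * t)) * p)
    + {ω | τD X y a ω ≤ τU X z b ω}.indicator (fun ω => α * discount r (τD X y a ω)) ω

/-- Price of the contract. -/
def price [MeasurableSpace Ω] (P : Measure Ω) (X : ℝ≥0 → Ω → ℝ) (r a b p α y z : ℝ) : ℝ :=
  ∫ ω, payoff X r a b p α y z ω ∂P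

/-- `ν(y, z)`: discounted probability of a drawdown not preceded by a drawup. -/
def nu [MeasurableSpace Ω] (P : Measure Ω) (X : ℝ≥0 → Ω → ℝ) (r a b y z : ℝ) : ℝ :=
  discountOn P r (τD X y a) {ω | τD X y a ω ≤ τU X z b ω}

/-- `λ(y, z)`: discounted probability of a drawup before the drawdown. -/
def lam [MeasurableSpace Ω] (P : Measure Ω) (X : ℝ≥0 → Ω → ℝ) (r a b y z : ℝ) : ℝ :=
  discountOn P r (τU X z b) {ω | τU X z b ω < τD X y a ω}

end Drawdown

end

/-!
The price formula is obtained by evaluating the premium integral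
`∫₀^τ e^{-rt} dt = (1 - e^{-rτ})/r` with `τ = τD ∧ τU` and by splitting according to which of the
two times comes first (`payoff_eq`).

The formula for `λ`, and that for `ν` when `y + z ≥ a`, hold path by path. As long as `X` stays
above `-z`, the drawup is `X + z`; as long as `X` stays below `y`, the drawdown is `y - X`. Hence a
drawup that comes first without a new minimum is a two-sided exit of `X`
(`τU_eq_coe_and_lt_τD_iff`), and so is a drawdown that comes first when `y + z ≥ a`
(`τD_eq_coe_and_le_τU_iff`). If the minimum has been renewed, the absence of positive jumps shows
that the drawdown precedes the drawup exactly when the running maximum at `τU`, or `y` if that is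
larger, exceeds the running minimum by at least `a` (`τD_le_iff_of_τU_eq`).

When `y + z < a`, a drawdown of size `a > b` that is not preceded by a drawup of size `b` can only
happen while `X` is at its running minimum, at most `-z` (`isMin_of_τD_le_τU`). At that time the
drawup process starts afresh from `0` (`drawup_add_eq_drawup_shift`), so that by the strong Markov
property `E[e^{-rτU}; τD ≤ τU] = ν(y, z) E[e^{-rτU⁰}]` (`discountOn_τU_eq_nu_mul`). The event on
the left can be read off from the extrema at `τU`, and the last factor is positive because `X` may
have many consecutive large increments (`measure_τU_ne_top_pos`).

No filtration is given and the σ-algebra need not be complete, so measurability requires care. The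
drawdown is upper semicontinuous along the path, which makes `{τD < t}` an event of the path up to
`t` (`isOptionalTime_τD`). The drawup may approach `b` and then jump down, and `τU` itself is shown
to be measurable only up to a null set: it equals almost surely the limit `approachTime` of the
first times at which the drawup exceeds `b - 1 / (n + 1)` (`ae_τU_eq_approachTime`). This rests on
quasi-left-continuity (`ae_frequently_le_of_isOptionalTime`). Both this and the restart use the
strong Markov property `lintegral_discount_mul_shift`, which is deduced from the independence and
stationarity of the increments by approximating the random time from above by grid-valued times.

All of this is done for a process whose paths are regular without exception; since every quantity
is a functional of the path, it may be computed for such a modification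
(`IsSpectrallyNegativeLevy.exists_regular_modification`).
-/

namespace Drawdown

open TopologicalSpace (denseSeq)

/-! ### Paths without positive jumps -/

/-- A path started at `0` that is right-continuous, has left limits and has no positive jumps. -/
structure IsRegularPath (f : ℝ≥0 → ℝ) : Prop where
  zero : f 0 = 0
  right_continuous : ∀ t, ContinuousWithinAt f (Ici t) t
  left_limit : ∀ t, ∃ l, Tendsto f (𝓝[<] t) (𝓝 l) ∧ f t ≤ l

lemma exists_Ico_forall_of_continuousWithinAt {f : ℝ≥0 → ℝ} {t : ℝ≥0}
    (h : ContinuousWithinAt f (Ici t) t) {p : ℝ → Prop} (hp : ∀ᶠ x in 𝓝 (f t), p x) :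
    ∃ u, t < u ∧ ∀ s, t ≤ s → s < u → p (f s) := by
  have h1 : ∀ᶠ s in 𝓝[≥] t, p (f s) := h.eventually hp
  obtain ⟨u, hu, hsub⟩ := (mem_nhdsGE_iff_exists_Ico_subset (a := t)).1 h1
  exact ⟨u, hu, fun s h1 h2 => hsub ⟨h1, h2⟩⟩

/-- An open condition on the value at `t` of a right-continuous function is satisfied at points of
the fixed countable dense set arbitrarily close to the right of `t`. -/
lemma exists_denseSeq_of_right_continuous {f : ℝ≥0 → ℝ} {t u : ℝ≥0}
    (h : ContinuousWithinAt f (Ici t) t) {p : ℝ → Prop} (hp : ∀ᶠ x in 𝓝 (f t), p x)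
    (hu : t < u) :
    ∃ n, t < denseSeq ℝ≥0 n ∧ denseSeq ℝ≥0 n < u ∧
      p (f (denseSeq ℝ≥0 n)) := by
  obtain ⟨v, hv, hf⟩ := exists_Ico_forall_of_continuousWithinAt h hp
  obtain ⟨_, ⟨n, rfl⟩, h1, h2⟩ :=
    (TopologicalSpace.denseRange_denseSeq ℝ≥0).exists_between (lt_min hu hv)
  exact ⟨n, h1, h2.trans_le (min_le_left _ _), hf _ h1.le (h2.trans_le (min_le_right _ _))⟩

lemma exists_denseSeq_between {s t : ℝ≥0} (h : s < t) :
    ∃ n, s < denseSeq ℝ≥0 n ∧ denseSeq ℝ≥0 n < t := by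
  obtain ⟨x, ⟨n, rfl⟩, hx⟩ := (TopologicalSpace.denseRange_denseSeq ℝ≥0).exists_between h
  exact ⟨n, hx⟩

namespace IsRegularPath

variable {f : ℝ≥0 → ℝ}

/-- Without positive jumps the path is lower semicontinuous. -/
lemma eventually_gt (hf : IsRegularPath f) {t : ℝ≥0} {c : ℝ} (hc : c < f t) :
    ∀ᶠ s in 𝓝 t, c < f s := by
  rw [← nhdsLT_sup_nhdsGE, eventually_sup]
  obtain ⟨l, hl, hle⟩ := hf.left_limit t
  exact ⟨hl.eventually_const_lt (hc.trans_le hle),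
    (hf.right_continuous t).eventually_const_lt hc⟩

lemma exists_min (hf : IsRegularPath f) (t : ℝ≥0) : ∃ s ≤ t, ∀ u ≤ t, f s ≤ f u := by
  have hc : IsCompact (Iic t) := by
    rw [← Icc_bot]; exact isCompact_Icc
  obtain ⟨s, hs, hmin⟩ := LowerSemicontinuousOn.exists_isMinOn (f := f) (nonempty_Iic (a := t)) hc
    (fun x _ c hc => (hf.eventually_gt hc).filter_mono nhdsWithin_le_nhds)
  exact ⟨s, hs, fun u hu => hmin hu⟩

lemma bddBelow (hf : IsRegularPath f) (t : ℝ≥0) : BddBelow (range fun s : Iic t => f s) := by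
  obtain ⟨s, -, h⟩ := hf.exists_min t
  exact ⟨f s, by rintro _ ⟨u, rfl⟩; exact h u u.2⟩

lemma bddAbove (hf : IsRegularPath f) (t : ℝ≥0) : BddAbove (range fun s : Iic t => f s) := by
  have hc : IsCompact (Iic t) := by
    rw [← Icc_bot]; exact isCompact_Icc
  have : BddAbove (f '' Iic t) := by
    refine hc.induction_on (p := fun s => BddAbove (f '' s)) (by simp)
      (fun s u hsu hu => hu.mono (image_mono hsu)) (fun s u hs hu => ?_) (fun x _ => ?_)
    · rw [image_union]; exact hs.union hu
    · obtain ⟨l, hl, hle⟩ := hf.left_limit x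
      have h1 : ∀ᶠ s in 𝓝 x, f s < l + 1 := by
        rw [← nhdsLT_sup_nhdsGE, eventually_sup]
        exact ⟨hl.eventually_lt_const (by linarith),
          (hf.right_continuous x).eventually_lt_const (by linarith)⟩
      refine ⟨_, mem_nhdsWithin_of_mem_nhds h1, l + 1, ?_⟩
      rintro _ ⟨s, hs, rfl⟩
      exact le_of_lt hs
  convert this using 1
  ext x; simp

/-- A bound that holds strictly before `t > 0` persists at `t`. -/
lemma le_of_forall_lt (hf : IsRegularPath f) {s t : ℝ≥0} {c : ℝ} (hst : s < t)
    (h : ∀ u, s ≤ u → u < t → f u ≤ c) : f t ≤ c := by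
  obtain ⟨l, hl, hle⟩ := hf.left_limit t
  have : (𝓝[<] t).NeBot := nhdsLT_neBot_of_exists_lt ⟨s, hst⟩
  refine hle.trans (le_of_tendsto hl ?_)
  filter_upwards [Ioo_mem_nhdsLT hst] with u hu using h u hu.1.le hu.2

end IsRegularPath

/-! ### Running extrema, drawdown and drawup of a regular path -/

section Path

variable {Ω : Type*} {X : ℝ≥0 → Ω → ℝ} {ω : Ω}

lemma exists_lt_of_lt_runMax {t : ℝ≥0} {c : ℝ} (h : c < runMax X t ω) : ∃ s ≤ t, c < X s ω := by
  obtain ⟨⟨s, hs⟩, h⟩ := exists_lt_of_lt_ciSup h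
  exact ⟨s, hs, h⟩

lemma runMax_le {t : ℝ≥0} {c : ℝ} (h : ∀ s ≤ t, X s ω ≤ c) : runMax X t ω ≤ c :=
  ciSup_le fun s => h s s.2

lemma le_runMin {t : ℝ≥0} {c : ℝ} (h : ∀ s ≤ t, c ≤ X s ω) : c ≤ runMin X t ω :=
  le_ciInf fun s => h s s.2

lemma le_drawdown (y : ℝ) (t : ℝ≥0) : y - X t ω ≤ drawdown X y t ω := by
  unfold drawdown; linarith [le_max_right (runMax X t ω) y]

lemma le_drawup (z : ℝ) (t : ℝ≥0) : X t ω + z ≤ drawup X z t ω := by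
  unfold drawup; linarith [min_le_right (runMin X t ω) (-z)]

variable (hω : IsRegularPath fun t => X t ω)
include hω

lemma le_runMax {s t : ℝ≥0} (h : s ≤ t) : X s ω ≤ runMax X t ω :=
  le_ciSup (hω.bddAbove t) (⟨s, h⟩ : Iic t)

lemma runMin_le {s t : ℝ≥0} (h : s ≤ t) : runMin X t ω ≤ X s ω :=
  ciInf_le (hω.bddBelow t) (⟨s, h⟩ : Iic t)

lemma exists_eq_runMin (t : ℝ≥0) : ∃ s ≤ t, X s ω = runMin X t ω := by
  obtain ⟨s, hs, h⟩ := hω.exists_min t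
  exact ⟨s, hs, le_antisymm (le_runMin h) (runMin_le hω hs)⟩

lemma runMax_mono {s t : ℝ≥0} (h : s ≤ t) : runMax X s ω ≤ runMax X t ω :=
  runMax_le fun _ hu => le_runMax hω (hu.trans h)

lemma runMin_anti {s t : ℝ≥0} (h : s ≤ t) : runMin X t ω ≤ runMin X s ω :=
  le_runMin fun _ hu => runMin_le hω (hu.trans h)

lemma runMax_right_continuous (t : ℝ≥0) :
    ContinuousWithinAt (fun s => runMax X s ω) (Ici t) t := by
  refine Metric.continuousWithinAt_iff'.2 fun ε hε => ?_
  obtain ⟨u, hu, h⟩ := exists_Ico_forall_of_continuousWithinAt (hω.right_continuous t)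
    (p := fun x => x < X t ω + ε / 2) (eventually_lt_nhds (by linarith))
  filter_upwards [Ico_mem_nhdsGE hu] with s hs
  have h1 := runMax_mono hω hs.1
  have h2 : runMax X s ω ≤ runMax X t ω + ε / 2 := by
    refine runMax_le fun v hv => ?_
    rcases le_total v t with h' | h'
    · linarith [le_runMax hω h']
    · linarith [h v h' (hv.trans_lt hs.2), le_runMax hω (le_refl t)]
  rw [Real.dist_eq, abs_lt]; constructor <;> linarith

lemma runMin_right_continuous (t : ℝ≥0) :
    ContinuousWithinAt (fun s => runMin X s ω) (Ici t) t := by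
  refine Metric.continuousWithinAt_iff'.2 fun ε hε => ?_
  obtain ⟨u, hu, h⟩ := exists_Ico_forall_of_continuousWithinAt (hω.right_continuous t)
    (p := fun x => X t ω - ε / 2 < x) (eventually_gt_nhds (by linarith))
  filter_upwards [Ico_mem_nhdsGE hu] with s hs
  have h1 := runMin_anti hω hs.1
  have h2 : runMin X t ω - ε / 2 ≤ runMin X s ω := by
    refine le_runMin fun v hv => ?_
    rcases le_total v t with h' | h'
    · linarith [runMin_le hω h']
    · linarith [h v h' (hv.trans_lt hs.2), runMin_le hω (le_refl t)]
  rw [Real.dist_eq, abs_lt]; constructor <;> linarith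

lemma drawdown_right_continuous (y : ℝ) (t : ℝ≥0) :
    ContinuousWithinAt (fun s => drawdown X y s ω) (Ici t) t :=
  ((runMax_right_continuous hω t).max continuousWithinAt_const).sub (hω.right_continuous t)

lemma drawup_right_continuous (z : ℝ) (t : ℝ≥0) :
    ContinuousWithinAt (fun s => drawup X z s ω) (Ici t) t :=
  (hω.right_continuous t).sub ((runMin_right_continuous hω t).min continuousWithinAt_const)

/-- The running maximum is continuous and the path is lower semicontinuous, so the drawdown is
upper semicontinuous. -/
lemma drawdown_eventually_lt {y c : ℝ} {t : ℝ≥0} (h : drawdown X y t ω < c) :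
    ∀ᶠ s in 𝓝 t, drawdown X y s ω < c := by
  rw [← nhdsLT_sup_nhdsGE, eventually_sup]
  refine ⟨?_, (drawdown_right_continuous hω y t).eventually_lt_const h⟩
  have h1 : max (runMax X t ω) y - c < X t ω := by unfold drawdown at h; linarith
  filter_upwards [(hω.eventually_gt h1).filter_mono nhdsWithin_le_nhds, self_mem_nhdsWithin]
    with s hs hst
  have := max_le_max_right y (runMax_mono hω (le_of_lt hst))
  unfold drawdown
  linarith

lemma lt_drawdown_iff {y c : ℝ} {t : ℝ≥0} :
    c < drawdown X y t ω ↔ c < y - X t ω ∨ ∃ s ≤ t, c < X s ω - X t ω := by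
  have : c < drawdown X y t ω ↔ c + X t ω < y ∨ c + X t ω < runMax X t ω := by
    rw [drawdown, lt_sub_iff_add_lt, lt_max_iff, or_comm]
  rw [this]
  refine or_congr (by constructor <;> intro <;> linarith) ⟨fun h => ?_, ?_⟩
  · obtain ⟨s, hs, h⟩ := exists_lt_of_lt_runMax h
    exact ⟨s, hs, by linarith⟩
  · rintro ⟨s, hs, h⟩
    linarith [le_runMax hω hs]

lemma lt_drawup_iff {z c : ℝ} {t : ℝ≥0} :
    c < drawup X z t ω ↔ c < X t ω + z ∨ ∃ s ≤ t, c < X t ω - X s ω := by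
  have : c < drawup X z t ω ↔ -z < X t ω - c ∨ runMin X t ω < X t ω - c := by
    rw [drawup, lt_sub_comm, min_lt_iff, or_comm]
  rw [this]
  refine or_congr (by constructor <;> intro <;> linarith) ⟨fun h => ?_, ?_⟩
  · obtain ⟨s, hs, h'⟩ := exists_eq_runMin hω t
    exact ⟨s, hs, by linarith⟩
  · rintro ⟨s, hs, h⟩
    linarith [runMin_le hω hs]

lemma sub_le_drawup (z : ℝ) {s t : ℝ≥0} (h : s ≤ t) : X t ω - X s ω ≤ drawup X z t ω := by
  unfold drawup; linarith [runMin_le hω h, min_le_left (runMin X t ω) (-z)]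

/-- The drawup increases at least as much as the path. -/
lemma drawup_add_le (z : ℝ) {s t : ℝ≥0} (h : s ≤ t) :
    drawup X z s ω + (X t ω - X s ω) ≤ drawup X z t ω := by
  unfold drawup; linarith [min_le_min_right (-z) (runMin_anti hω h)]

end Path

/-! ### Hitting times of closed sets by right-continuous paths -/

section Hitting

variable {Ω : Type*} {Y : ℝ≥0 → Ω → ℝ} {S : Set ℝ} {c : ℝ} {ω : Ω}

lemma mem_of_hittingAfter_eq_coe (hS : IsClosed S)
    (hY : ∀ t, ContinuousWithinAt (fun s => Y s ω) (Ici t) t) {t : ℝ≥0}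
    (h : hittingAfter Y S 0 ω = t) : Y t ω ∈ S := by
  by_contra hn
  obtain ⟨u, hu, h1⟩ := exists_Ico_forall_of_continuousWithinAt (hY t) (p := fun x => x ∈ Sᶜ)
    (hS.isOpen_compl.mem_nhds hn)
  have h2 : hittingAfter Y S 0 ω < (u : WithTop ℝ≥0) := by rw [h]; exact_mod_cast hu
  obtain ⟨j, hj, hjS⟩ := hittingAfter_lt_iff.1 h2
  have h3 : hittingAfter Y S 0 ω ≤ (j : WithTop ℝ≥0) := hittingAfter_le_of_mem hj.1 hjS
  rw [h] at h3
  exact h1 j (by exact_mod_cast h3) hj.2 hjS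

lemma timeAbove_le {t : ℝ≥0} (h : c ≤ Y t ω) : timeAbove Y c ω ≤ t :=
  hittingAfter_le_of_mem zero_le h

lemma timeBelow_le {t : ℝ≥0} (h : Y t ω ≤ c) : timeBelow Y c ω ≤ t :=
  hittingAfter_le_of_mem zero_le h

lemma lt_of_lt_timeAbove {t : ℝ≥0} (h : t < timeAbove Y c ω) : Y t ω < c := by
  by_contra! hn
  exact absurd (timeAbove_le hn) (not_le.2 h)

lemma lt_of_lt_timeBelow {t : ℝ≥0} (h : t < timeBelow Y c ω) : c < Y t ω := by
  by_contra! hn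
  exact absurd (timeBelow_le hn) (not_le.2 h)

lemma timeAbove_lt_iff {t : ℝ≥0} : timeAbove Y c ω < t ↔ ∃ s < t, c ≤ Y s ω := by
  rw [timeAbove, hittingAfter_lt_iff]; simp

lemma le_of_timeAbove_eq (hY : ∀ t, ContinuousWithinAt (fun s => Y s ω) (Ici t) t) {t : ℝ≥0}
    (h : timeAbove Y c ω = t) : c ≤ Y t ω :=
  mem_of_hittingAfter_eq_coe isClosed_Ici hY h

lemma le_of_timeBelow_eq (hY : ∀ t, ContinuousWithinAt (fun s => Y s ω) (Ici t) t) {t : ℝ≥0}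
    (h : timeBelow Y c ω = t) : Y t ω ≤ c :=
  mem_of_hittingAfter_eq_coe isClosed_Iic hY h

lemma timeAbove_le_iff (hY : ∀ t, ContinuousWithinAt (fun s => Y s ω) (Ici t) t) {t : ℝ≥0} :
    timeAbove Y c ω ≤ t ↔ ∃ s ≤ t, c ≤ Y s ω := by
  refine ⟨fun h => ?_, fun ⟨s, hs, h⟩ => (timeAbove_le h).trans (by exact_mod_cast hs)⟩
  obtain ⟨s, hs⟩ := WithTop.ne_top_iff_exists.1 (ne_top_of_le_ne_top WithTop.coe_ne_top h)
  rw [← hs] at h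
  exact ⟨s, by exact_mod_cast h, le_of_timeAbove_eq hY hs.symm⟩

lemma lt_timeAbove_iff (hY : ∀ t, ContinuousWithinAt (fun s => Y s ω) (Ici t) t) {t : ℝ≥0} :
    t < timeAbove Y c ω ↔ ∀ s ≤ t, Y s ω < c := by
  rw [← not_le, timeAbove_le_iff hY]; push Not; rfl

lemma lt_timeBelow_iff (hY : ∀ t, ContinuousWithinAt (fun s => Y s ω) (Ici t) t) {t : ℝ≥0} :
    t < timeBelow Y c ω ↔ ∀ s ≤ t, c < Y s ω := by
  refine ⟨fun h s hs => lt_of_lt_timeBelow (lt_of_le_of_lt (by exact_mod_cast hs) h),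
    fun h => ?_⟩
  by_contra! hn
  obtain ⟨s, hs⟩ := WithTop.ne_top_iff_exists.1 (ne_top_of_le_ne_top WithTop.coe_ne_top hn)
  rw [← hs] at hn
  exact absurd (le_of_timeBelow_eq hY hs.symm) (not_le.2 (h s (by exact_mod_cast hn)))

lemma timeAbove_eq_coe_iff (hY : ∀ t, ContinuousWithinAt (fun s => Y s ω) (Ici t) t) {t : ℝ≥0} :
    timeAbove Y c ω = t ↔ c ≤ Y t ω ∧ ∀ s < t, Y s ω < c := by
  refine ⟨fun h => ⟨le_of_timeAbove_eq hY h, fun s hs => lt_of_lt_timeAbove ?_⟩,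
    fun ⟨h1, h2⟩ => le_antisymm (timeAbove_le h1) ?_⟩
  · rw [h]; exact_mod_cast hs
  · by_contra! hn
    obtain ⟨s, hs, h⟩ := timeAbove_lt_iff.1 hn
    exact absurd h (not_le.2 (h2 s hs))

lemma timeBelow_eq_coe_iff (hY : ∀ t, ContinuousWithinAt (fun s => Y s ω) (Ici t) t) {t : ℝ≥0} :
    timeBelow Y c ω = t ↔ Y t ω ≤ c ∧ ∀ s < t, c < Y s ω := by
  refine ⟨fun h => ⟨le_of_timeBelow_eq hY h, fun s hs => lt_of_lt_timeBelow ?_⟩,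
    fun ⟨h1, h2⟩ => le_antisymm (timeBelow_le h1) ?_⟩
  · rw [h]; exact_mod_cast hs
  · by_contra! hn
    obtain ⟨s, hs, h⟩ := hittingAfter_lt_iff.1 hn
    exact absurd h (not_le.2 (h2 s hs.2))

/-- For an upper semicontinuous, right-continuous path, being hit strictly before `t` is a
countable combination of events at times before `t`. -/
lemma timeAbove_lt_iff_denseSeq (hY : ∀ t, ContinuousWithinAt (fun s => Y s ω) (Ici t) t)
    (husc : ∀ t, ∀ c, Y t ω < c → ∀ᶠ s in 𝓝 t, Y s ω < c) {t : ℝ≥0} :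
    timeAbove Y c ω < t ↔ ∃ k, denseSeq ℝ≥0 k < t ∧ ∀ n : ℕ, ∃ j,
      denseSeq ℝ≥0 j ≤ denseSeq ℝ≥0 k ∧
      c - 1 / (n + 1) < Y (denseSeq ℝ≥0 j) ω := by
  rw [timeAbove_lt_iff]
  constructor
  · rintro ⟨s, hs, h⟩
    obtain ⟨k, hk, hkt⟩ := exists_denseSeq_between hs
    refine ⟨k, hkt, fun n => ?_⟩
    have h0 : (0 : ℝ) < 1 / (n + 1) := by positivity
    obtain ⟨j, -, hj, hjY⟩ := exists_denseSeq_of_right_continuous (hY s)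
      (p := fun x => c - 1 / (n + 1) < x) (eventually_gt_nhds (by linarith)) hk
    exact ⟨j, hj.le, hjY⟩
  · rintro ⟨k, hk, h⟩
    have hc : IsCompact (Iic (denseSeq ℝ≥0 k)) := by
      rw [← Icc_bot]; exact isCompact_Icc
    obtain ⟨s, hs, hmax⟩ := UpperSemicontinuousOn.exists_isMaxOn (f := fun s => Y s ω)
      nonempty_Iic hc (fun x _ c hc => (husc x c hc).filter_mono nhdsWithin_le_nhds)
    refine ⟨s, lt_of_le_of_lt hs hk, le_of_forall_pos_lt_add fun ε hε => ?_⟩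
    obtain ⟨n, hn⟩ := exists_nat_one_div_lt hε
    obtain ⟨j, hj, hjY⟩ := h n
    have : Y (denseSeq ℝ≥0 j) ω ≤ Y s ω := hmax hj
    linarith

end Hitting

/-! ### Pathwise comparison of drawdown, drawup and first passage times -/

lemma discount_top (r : ℝ) : discount r ⊤ = 0 := by simp [discount]

lemma discount_coe (r : ℝ) (t : ℝ≥0) : discount r t = Real.exp (-(r * t)) := by
  rw [discount, if_neg WithTop.coe_ne_top, WithTop.untopD_coe]

lemma discount_nonneg (r : ℝ) (τ : WithTop ℝ≥0) : 0 ≤ discount r τ := by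
  unfold discount; split_ifs <;> positivity

lemma discount_le_one {r : ℝ} (hr : 0 ≤ r) (τ : WithTop ℝ≥0) : discount r τ ≤ 1 := by
  induction τ using WithTop.recTopCoe with
  | top => simp [discount_top]
  | coe t => rw [discount_coe, Real.exp_le_one_iff]; have := t.2; simp only [neg_nonpos]; positivity

lemma discount_add (r : ℝ) (t : ℝ≥0) (τ : WithTop ℝ≥0) :
    discount r (t + τ) = discount r t * discount r τ := by
  induction τ using WithTop.recTopCoe with
  | top => rw [WithTop.add_top, discount_top, mul_zero]
  | coe u =>
    rw [← WithTop.coe_add, discount_coe, discount_coe, discount_coe, ← Real.exp_add]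
    push_cast; ring_nf

/-- The process of increments after the random time `T`. -/
def shift {Ω : Type*} (X : ℝ≥0 → Ω → ℝ) (T : Ω → ℝ≥0) (u : ℝ≥0) (ω : Ω) : ℝ :=
  X (T ω + u) ω - X (T ω) ω

lemma indicator_ofPred_of_pos {Ω : Type*} {p : Ω → Prop} {g : Ω → ℝ} {ω : Ω} (h : p ω) :
    {ω | p ω}.indicator g ω = g ω :=
  indicator_of_mem (s := {ω | p ω}) h g

lemma indicator_ofPred_of_neg {Ω : Type*} {p : Ω → Prop} {g : Ω → ℝ} {ω : Ω} (h : ¬ p ω) :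
    {ω | p ω}.indicator g ω = 0 :=
  indicator_of_notMem (s := {ω | p ω}) h g

lemma indicator_ofPred_congr {Ω : Type*} {p q : Ω → Prop} {g : Ω → ℝ} {ω : Ω}
    (h : p ω ↔ q ω) : {ω | p ω}.indicator g ω = {ω | q ω}.indicator g ω := by
  by_cases hp : p ω
  · rw [indicator_ofPred_of_pos hp, indicator_ofPred_of_pos (h.1 hp)]
  · rw [indicator_ofPred_of_neg hp, indicator_ofPred_of_neg (mt h.2 hp)]

section Path

variable {Ω : Type*} {X : ℝ≥0 → Ω → ℝ} {ω : Ω} {a b y z : ℝ}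

lemma stoppedValue_of_eq_coe {u : ℝ≥0 → Ω → ℝ} {τ : Ω → WithTop ℝ≥0} {t : ℝ≥0} (h : τ ω = t) :
    stoppedValue u τ ω = u t ω := by
  rw [stoppedValue, h]; rfl

variable (hω : IsRegularPath fun t => X t ω)
include hω

lemma τD_eq_coe_iff {t : ℝ≥0} : τD X y a ω = t ↔
    a ≤ drawdown X y t ω ∧ ∀ s < t, drawdown X y s ω < a :=
  timeAbove_eq_coe_iff (drawdown_right_continuous hω y)

lemma lt_τD_iff {t : ℝ≥0} : t < τD X y a ω ↔ ∀ s ≤ t, drawdown X y s ω < a :=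
  lt_timeAbove_iff (drawdown_right_continuous hω y)

lemma τU_eq_coe_iff {t : ℝ≥0} : τU X z b ω = t ↔
    b ≤ drawup X z t ω ∧ ∀ s < t, drawup X z s ω < b :=
  timeAbove_eq_coe_iff (drawup_right_continuous hω z)

omit hω in
lemma le_τU_iff {t : ℝ≥0} : t ≤ τU X z b ω ↔ ∀ s < t, drawup X z s ω < b := by
  rw [← not_lt, τU, timeAbove_lt_iff]; push Not; rfl

/-- A drawdown of size `a > b` that is not preceded by a drawup of size `b` happens while the path
is at its running minimum, which is at most the initial minimum `-z`. -/
lemma isMin_of_τD_le_τU (hb : 0 < b) (hab : b < a) (hyz : y + z < a) {t : ℝ≥0}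
    (hD : τD X y a ω = t) (hU : t ≤ τU X z b ω) :
    (∀ s ≤ t, X t ω ≤ X s ω) ∧ X t ω ≤ -z := by
  obtain ⟨hDt, hDs⟩ := (τD_eq_coe_iff hω).1 hD
  have hUs := le_τU_iff.1 hU
  rw [drawdown, le_sub_iff_add_le, le_max_iff] at hDt
  rcases hDt with h | h
  · constructor
    · intro s hs
      by_contra! hlt
      -- if `X s < X t`, the path climbs by more than `b` above `X s` between `s` and `t`, because
      -- the drawdown at `s` was still smaller than `a`
      have hst : s < t := lt_of_le_of_ne hs (by rintro rfl; exact lt_irrefl _ hlt)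
      have h1 := hDs s hst
      have h2 : runMax X s ω < X s ω + a := by
        have := le_max_left (runMax X s ω) y
        unfold drawdown at h1; linarith
      obtain ⟨m, hm, hX⟩ := exists_lt_of_lt_runMax (ω := ω) (X := X) (t := t)
        (c := max (runMax X s ω) (max (X s ω + b) (X t ω)))
        (max_lt (by linarith) (max_lt (by linarith) (by linarith)))
      rw [max_lt_iff, max_lt_iff] at hX
      have hsm : s ≤ m := by
        by_contra! hms
        linarith [le_runMax hω hms.le]
      have hmt : m < t := lt_of_le_of_ne hm (by rintro rfl; exact lt_irrefl _ hX.2.2)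
      linarith [hUs m hmt, sub_le_drawup hω z hsm]
    · obtain ⟨m, hm, hX⟩ := exists_lt_of_lt_runMax (ω := ω) (X := X) (t := t)
        (c := X t ω + b) (by linarith)
      have hmt : m < t := lt_of_le_of_ne hm (by rintro rfl; linarith)
      linarith [hUs m hmt, le_drawup (X := X) (ω := ω) z m]
  · refine ⟨fun s hs => ?_, by linarith⟩
    rcases eq_or_lt_of_le hs with rfl | hst
    · exact le_rfl
    · linarith [hDs s hst, le_drawdown (X := X) (ω := ω) y s]

/-- If the path is at its running minimum below `-z` at time `T`, then the drawup starts afresh from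
`0` at that time. -/
lemma drawup_add_eq_drawup_shift {T : Ω → ℝ≥0} (hmin : ∀ s ≤ T ω, X (T ω) ω ≤ X s ω)
    (hz : X (T ω) ω ≤ -z) (u : ℝ≥0) :
    drawup X z (T ω + u) ω = drawup (shift X T) 0 u ω := by
  have hle : X (T ω) ω ∈ Set.Ici (runMin X (T ω + u) ω) := runMin_le hω le_self_add
  have hsh : runMin (shift X T) u ω = runMin X (T ω + u) ω - X (T ω) ω := by
    obtain ⟨s, hs, hseq⟩ := exists_eq_runMin hω (T ω + u)
    refine le_antisymm ?_ (le_ciInf fun v => ?_)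
    · have hbdd : BddBelow (range fun v : Iic u => shift X T v ω) := by
        refine ⟨runMin X (T ω + u) ω - X (T ω) ω, ?_⟩
        rintro _ ⟨v, rfl⟩
        exact sub_le_sub_right (runMin_le hω (add_le_add_right v.2 _)) _
      rcases le_total s (T ω) with h | h
      · refine (ciInf_le hbdd ⟨0, mem_Iic.2 zero_le⟩).trans ?_
        simp only [shift, add_zero]
        linarith [hmin s h]
      · refine (ciInf_le hbdd ⟨s - T ω, tsub_le_iff_left.2 hs⟩).trans ?_
        simp only [shift, add_tsub_cancel_of_le h, hseq, le_refl]
    · exact sub_le_sub_right (runMin_le hω (add_le_add_right v.2 _)) _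
  simp only [drawup, hsh, shift, neg_zero]
  rw [min_eq_left (le_trans hle hz), min_eq_left (sub_nonpos.2 hle)]
  ring

lemma isRegularPath_shift (T : Ω → ℝ≥0) : IsRegularPath fun t => shift X T t ω where
  zero := by simp [shift]
  right_continuous t := by
    have h1 : Tendsto (fun s => T ω + s) (𝓝[Ici t] t) (𝓝[Ici (T ω + t)] (T ω + t)) :=
      ((continuous_const.add continuous_id).continuousWithinAt).tendsto_nhdsWithin
        fun s hs => add_le_add_right (show t ≤ s from hs) _
    exact ((hω.right_continuous (T ω + t)).tendsto.comp h1).sub tendsto_const_nhds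
  left_limit t := by
    obtain ⟨l, hl, hle⟩ := hω.left_limit (T ω + t)
    have h1 : Tendsto (fun s => T ω + s) (𝓝[<] t) (𝓝[<] (T ω + t)) :=
      ((continuous_const.add continuous_id).continuousWithinAt).tendsto_nhdsWithin
        fun s hs => add_lt_add_right (show s < t from hs) _
    exact ⟨l - X (T ω) ω, (hl.comp h1).sub tendsto_const_nhds, sub_le_sub_right hle _⟩

/-- At the drawup time the path may have had its drawdown only before the running minimum, because
it has not yet climbed by more than `b < a` above that minimum. -/
lemma τD_le_iff_of_τU_eq (hb : 0 < b) (hab : b < a) {t : ℝ≥0} (hU : τU X z b ω = t)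
    (hmin : runMin X t ω ≤ -z) :
    τD X y a ω ≤ t ↔ a ≤ max (runMax X t ω) y - runMin X t ω := by
  constructor
  · contrapose!
    intro h
    refine (lt_τD_iff hω).2 fun s hs => lt_of_le_of_lt ?_ h
    exact sub_le_sub (max_le_max_right _ (runMax_mono hω hs)) (runMin_le hω hs)
  · contrapose!
    intro h
    rw [lt_τD_iff hω] at h
    obtain ⟨-, hUs⟩ := (τU_eq_coe_iff hω).1 hU
    obtain ⟨s, hs, hseq⟩ := exists_eq_runMin hω t
    have hDs := h s hs
    rw [drawdown, sub_lt_iff_lt_add, max_lt_iff] at hDs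
    have hlt : ∀ u, s ≤ u → u < t → X u ω ≤ X s ω + b := fun u hsu hut => by
      linarith [hUs u hut, sub_le_drawup hω z hsu]
    have hmax : runMax X t ω ≤ max (runMax X s ω) (X s ω + b) := by
      refine runMax_le fun u hu => ?_
      rcases le_total u s with hus | hsu
      · exact le_max_of_le_left (le_runMax hω hus)
      · refine le_max_of_le_right ?_
        rcases eq_or_lt_of_le hu with rfl | hut
        · rcases eq_or_lt_of_le hsu with rfl | hsu
          · linarith
          · exact hω.le_of_forall_lt hsu hlt
        · exact hlt u hsu hut
    have := max_lt hDs.1 (show X s ω + b < a + X s ω by linarith)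
    rw [← hseq, sub_lt_iff_lt_add]
    exact max_lt (lt_of_le_of_lt hmax this) hDs.2

lemma runMax_le_of_τU_eq (hb : 0 < b) {t : ℝ≥0} (hU : τU X z b ω = t)
    (hmin : runMin X t ω ≤ -z) : runMax X t ω ≤ b - z := by
  obtain ⟨-, hUs⟩ := (τU_eq_coe_iff hω).1 hU
  have hlt : ∀ u, 0 ≤ u → u < t → X u ω ≤ b - z := fun u _ hut => by
    linarith [hUs u hut, le_drawup (X := X) (ω := ω) z u]
  refine runMax_le fun u hu => ?_
  rcases eq_or_lt_of_le hu with rfl | hut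
  · rcases eq_or_lt_of_le (zero_le : 0 ≤ u) with rfl | h0
    · obtain ⟨s, hs, hseq⟩ := exists_eq_runMin hω 0
      obtain rfl : s = 0 := le_antisymm hs zero_le
      linarith
    · exact hω.le_of_forall_lt h0 hlt
  · exact hlt u zero_le hut

/-- For `y + z < a`, the event `τD ≤ τU` can be read off from the extrema at the drawup time. -/
lemma τD_le_τU_iff_of_τU_eq (hb : 0 < b) (hab : b < a) (hyz : y + z < a) {t : ℝ≥0}
    (hU : τU X z b ω = t) :
    τD X y a ω ≤ τU X z b ω ↔ a ≤ max (runMax X t ω) y - runMin X t ω ∧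
      runMin X t ω ≤ -z ∧ runMax X t ω ≤ b - z := by
  constructor
  · intro h
    obtain ⟨s, hs⟩ := WithTop.ne_top_iff_exists.1
      (ne_top_of_le_ne_top (hU ▸ WithTop.coe_ne_top) h)
    have hmin := isMin_of_τD_le_τU hω hb hab hyz hs.symm (hs ▸ h)
    have hst : s ≤ t := by rw [← hs, hU] at h; exact_mod_cast h
    have hm : runMin X t ω ≤ -z := (runMin_le hω hst).trans hmin.2
    exact ⟨(τD_le_iff_of_τU_eq hω hb hab hU hm).1 (hU ▸ h), hm, runMax_le_of_τU_eq hω hb hU hm⟩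
  · rintro ⟨h1, h2, -⟩
    rw [hU]
    exact (τD_le_iff_of_τU_eq hω hb hab hU h2).2 h1

/-- For `y + z ≥ a`, the drawdown comes first exactly if the path passes below `y - a` before it
reaches `b - z`, and then at that time. -/
lemma τD_eq_coe_and_le_τU_iff (hab : b < a) (hy : 0 ≤ y) (hyz : y < a ∨ z < b)
    (hle : a ≤ y + z) {t : ℝ≥0} :
    (τD X y a ω = t ∧ t ≤ τU X z b ω) ↔
      (timeBelow X (y - a) ω = t ∧ t < timeAbove X (b - z) ω) := by
  rw [τD_eq_coe_iff hω, le_τU_iff, timeBelow_eq_coe_iff hω.right_continuous,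
    lt_timeAbove_iff hω.right_continuous]
  have h0 := hω.zero
  constructor
  · rintro ⟨⟨hDt, hDs⟩, hUs⟩
    have hlt : ∀ s < t, X s ω < b - z := fun s hs => by
      linarith [hUs s hs, le_drawup (X := X) (ω := ω) z s]
    have hgt : ∀ s < t, y - a < X s ω := fun s hs => by
      linarith [hDs s hs, le_drawdown (X := X) (ω := ω) y s]
    have ht : X t ω ≤ y - a := by
      by_contra! hn
      rw [drawdown, le_sub_iff_add_le, le_max_iff] at hDt
      have hM : y < runMax X t ω ∧ a + X t ω ≤ runMax X t ω := by
        rcases hDt with h | h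
        · exact ⟨by linarith, h⟩
        · linarith
      rcases eq_or_lt_of_le (zero_le : 0 ≤ t) with rfl | htpos
      · obtain ⟨s, hs, h⟩ := exists_lt_of_lt_runMax hM.1
        obtain rfl : s = 0 := le_antisymm hs zero_le
        linarith
      · have := hlt 0 htpos
        have := hgt 0 htpos
        obtain ⟨m, hm, hX⟩ := exists_lt_of_lt_runMax (X := X) (ω := ω) (t := t)
          (c := max y (X t ω)) (max_lt hM.1 (by linarith))
        rw [max_lt_iff] at hX
        have hmt : m < t := lt_of_le_of_ne hm (by rintro rfl; exact lt_irrefl _ hX.2)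
        linarith [hlt m hmt]
    refine ⟨⟨ht, hgt⟩, fun s hs => ?_⟩
    rcases eq_or_lt_of_le hs with rfl | hst
    · rcases eq_or_lt_of_le (zero_le : 0 ≤ s) with rfl | htpos
      · rcases hyz with h | h <;> linarith
      · linarith [hlt 0 htpos, hgt 0 htpos]
    · exact hlt s hst
  · rintro ⟨⟨ht, hgt⟩, hlt⟩
    refine ⟨⟨by linarith [le_drawdown (X := X) (ω := ω) y t], fun s hs => ?_⟩, fun s hs => ?_⟩
    · have hM : runMax X s ω ≤ y := runMax_le fun u hu => by
        linarith [hlt u (hu.trans hs.le)]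
      rw [drawdown, max_eq_right hM]
      linarith [hgt s hs]
    · obtain ⟨u, hu, hueq⟩ := exists_eq_runMin hω s
      rw [drawup, min_eq_right (by linarith [hgt u (hu.trans_lt hs)])]
      linarith [hlt s hs.le]

/-- While the path has not gone below `-z`, the drawup is `X + z`; hence on the event that the
drawup comes first without the minimum being renewed it is a two-sided exit of `X`. -/
lemma τU_eq_coe_and_lt_τD_iff (hb : 0 < b) (hab : b < a) {t : ℝ≥0} :
    (τU X z b ω = t ∧ t < τD X y a ω ∧ -z < runMin X t ω) ↔
      (timeAbove X (b - z) ω = t ∧ t < timeBelow X (max (y - a) (-z)) ω) := by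
  rw [τU_eq_coe_iff hω, lt_τD_iff hω, timeAbove_eq_coe_iff hω.right_continuous,
    lt_timeBelow_iff hω.right_continuous]
  have hdU : -z < runMin X t ω → ∀ s ≤ t, drawup X z s ω = X s ω + z := fun h s hs => by
    rw [drawup, min_eq_right (h.le.trans (runMin_anti hω hs))]; ring
  constructor
  · rintro ⟨⟨hUt, hUs⟩, hD, hm⟩
    refine ⟨⟨?_, fun s hs => ?_⟩, fun s hs => max_lt ?_ ?_⟩
    · rw [hdU hm t le_rfl] at hUt; linarith
    · have := hUs s hs
      rw [hdU hm s hs.le] at this; linarith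
    · linarith [hD s hs, le_drawdown (X := X) (ω := ω) y s]
    · linarith [runMin_le hω hs]
  · rintro ⟨⟨ht, hlt⟩, hgt⟩
    have hm : -z < runMin X t ω := by
      obtain ⟨s, hs, hseq⟩ := exists_eq_runMin hω t
      rw [← hseq]
      exact (max_lt_iff.1 (hgt s hs)).2
    refine ⟨⟨?_, fun s hs => ?_⟩, fun s hs => ?_, hm⟩
    · rw [hdU hm t le_rfl]; linarith
    · rw [hdU hm s hs.le]; linarith [hlt s hs]
    · have h1 := max_lt_iff.1 (hgt s hs)
      rw [drawdown, sub_lt_iff_lt_add]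
      refine max_lt ?_ (by linarith)
      refine lt_of_le_of_lt (b := max (X s ω) (b - z)) (runMax_le fun u hu => ?_)
        (max_lt (by linarith) (by linarith))
      rcases eq_or_lt_of_le hu with rfl | hus
      · exact le_max_left _ _
      · exact le_max_of_le_right (hlt u (hus.trans_le hs)).le

/-- Pathwise form of the formula for `ν` when `y + z ≥ a`. -/
lemma indicator_discount_τD_of_le (r : ℝ) (hab : b < a) (hy : 0 ≤ y) (hyz : y < a ∨ z < b)
    (hle : a ≤ y + z) :
    {ω | τD X y a ω ≤ τU X z b ω}.indicator (fun ω => discount r (τD X y a ω)) ω =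
      {ω | timeBelow X (y - a) ω < timeAbove X (b - z) ω}.indicator
        (fun ω => discount r (timeBelow X (y - a) ω)) ω := by
  have key := fun t : ℝ≥0 => τD_eq_coe_and_le_τU_iff hω (t := t) hab hy hyz hle
  by_cases h : timeBelow X (y - a) ω < timeAbove X (b - z) ω
  · obtain ⟨t, ht⟩ := WithTop.ne_top_iff_exists.1 h.ne_top
    have hk := (key t).2 ⟨ht.symm, ht ▸ h⟩
    rw [indicator_ofPred_of_pos (p := fun ω => τD X y a ω ≤ τU X z b ω) (hk.1.trans_le hk.2),
      indicator_ofPred_of_pos (p := fun ω => timeBelow X (y - a) ω < timeAbove X (b - z) ω) h,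
      hk.1, ht]
  · rw [indicator_ofPred_of_neg (p := fun ω => timeBelow X (y - a) ω < timeAbove X (b - z) ω) h]
    by_cases h2 : τD X y a ω ≤ τU X z b ω
    · rw [indicator_ofPred_of_pos (p := fun ω => τD X y a ω ≤ τU X z b ω) h2]
      by_cases h3 : τD X y a ω = ⊤
      · rw [h3, discount_top]
      · obtain ⟨t, ht⟩ := WithTop.ne_top_iff_exists.1 h3
        have hk := (key t).1 ⟨ht.symm, ht ▸ h2⟩
        exact absurd (hk.1.trans_lt hk.2) h
    · rw [indicator_ofPred_of_neg (p := fun ω => τD X y a ω ≤ τU X z b ω) h2]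

/-- Pathwise form of the formula for `λ`. -/
lemma indicator_discount_τU (r : ℝ) (hb : 0 < b) (hab : b < a) :
    {ω | τU X z b ω < τD X y a ω}.indicator (fun ω => discount r (τU X z b ω)) ω =
      {ω | timeAbove X (b - z) ω < timeBelow X (max (y - a) (-z)) ω}.indicator
        (fun ω => discount r (timeAbove X (b - z) ω)) ω +
      {ω | max (stoppedValue (runMax X) (τU X z b) ω) y
          - stoppedValue (runMin X) (τU X z b) ω < a ∧
          stoppedValue (runMin X) (τU X z b) ω ≤ -z}.indicator
        (fun ω => discount r (τU X z b ω)) ω := by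
  have key := fun t : ℝ≥0 => τU_eq_coe_and_lt_τD_iff hω (t := t) (y := y) (z := z) hb hab
  by_cases h : timeAbove X (b - z) ω < timeBelow X (max (y - a) (-z)) ω
  · obtain ⟨t, ht⟩ := WithTop.ne_top_iff_exists.1 h.ne_top
    have hk := (key t).2 ⟨ht.symm, ht ▸ h⟩
    rw [indicator_ofPred_of_pos (p := fun ω => τU X z b ω < τD X y a ω) (hk.1.trans_lt hk.2.1),
      indicator_ofPred_of_pos
        (p := fun ω => timeAbove X (b - z) ω < timeBelow X (max (y - a) (-z)) ω) h,
      indicator_ofPred_of_neg, hk.1, ht, add_zero]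
    rintro ⟨-, h2⟩
    rw [stoppedValue_of_eq_coe hk.1] at h2
    exact absurd h2 (not_le.2 hk.2.2)
  · rw [indicator_ofPred_of_neg
      (p := fun ω => timeAbove X (b - z) ω < timeBelow X (max (y - a) (-z)) ω) h, zero_add]
    by_cases h3 : τU X z b ω = ⊤
    · simp [indicator, h3, discount_top]
    · obtain ⟨t, ht⟩ := WithTop.ne_top_iff_exists.1 h3
      refine indicator_ofPred_congr ?_
      rw [stoppedValue_of_eq_coe ht.symm, stoppedValue_of_eq_coe ht.symm, ← ht]
      by_cases hm : runMin X t ω ≤ -z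
      · have := τD_le_iff_of_τU_eq hω (y := y) hb hab ht.symm hm
        rw [← not_le, this, not_le]
        exact ⟨fun h => ⟨h, hm⟩, And.left⟩
      · refine ⟨fun h4 => absurd ?_ h, fun h4 => absurd h4.2 hm⟩
        have := (key t).1 ⟨ht.symm, h4, not_le.1 hm⟩
        exact this.1.trans_lt this.2

/-- Up to the discount factor, the event of the formula for `ν` when `y + z < a` is `τD ≤ τU`. -/
lemma indicator_discount_τU_of_lt (r : ℝ) (hb : 0 < b) (hab : b < a) (hyz : y + z < a) :
    {ω | a ≤ max (stoppedValue (runMax X) (τU X z b) ω) y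
          - stoppedValue (runMin X) (τU X z b) ω ∧
        stoppedValue (runMin X) (τU X z b) ω ≤ -z ∧
        stoppedValue (runMax X) (τU X z b) ω ≤ b - z}.indicator
        (fun ω => discount r (τU X z b ω)) ω =
      {ω | τD X y a ω ≤ τU X z b ω}.indicator (fun ω => discount r (τU X z b ω)) ω := by
  by_cases h3 : τU X z b ω = ⊤
  · simp [indicator, h3, discount_top]
  · obtain ⟨t, ht⟩ := WithTop.ne_top_iff_exists.1 h3
    refine indicator_ofPred_congr ?_
    rw [τD_le_τU_iff_of_τU_eq hω hb hab hyz ht.symm, stoppedValue_of_eq_coe ht.symm,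
      stoppedValue_of_eq_coe ht.symm]

end Path

/-! ### The Markov property at deterministic times -/

section Markov

variable {Ω : Type*}

/-- The σ-algebra generated by the process up to time `t`. -/
abbrev past (X : ℝ≥0 → Ω → ℝ) (t : ℝ≥0) : MeasurableSpace Ω :=
  MeasurableSpace.comap (fun ω (s : Iic t) => X s ω) inferInstance

lemma measurable_past (X : ℝ≥0 → Ω → ℝ) {s t : ℝ≥0} (h : s ≤ t) : Measurable[past X t] (X s) := by
  have h1 : Measurable[past X t] (fun ω (s : Iic t) => X s ω) := comap_measurable _
  exact (measurable_pi_apply (⟨s, h⟩ : Iic t)).comp h1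

lemma past_mono (X : ℝ≥0 → Ω → ℝ) {s t : ℝ≥0} (h : s ≤ t) : past X s ≤ past X t := by
  refine Measurable.comap_le (m₁ := past X t) ?_
  exact @measurable_pi_lambda _ _ _ (past X t) _ _ fun u => measurable_past X (le_trans u.2 h)

variable [MeasurableSpace Ω] {X : ℝ≥0 → Ω → ℝ} {P : Measure Ω}

lemma past_le (hX : ∀ t, Measurable (X t)) (t : ℝ≥0) : past X t ≤ ‹MeasurableSpace Ω› :=
  (measurable_pi_lambda _ fun s : Iic t => hX s).comap_le

lemma exists_monotone_seq (K : Finset ℝ≥0) :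
    ∃ s : ℕ → ℝ≥0, Monotone s ∧ s 0 = 0 ∧ ∀ t ∈ K, ∃ k, s k = t := by
  set L := insert 0 K
  have hL : 0 < L.card := Finset.card_pos.2 ⟨0, Finset.mem_insert_self _ _⟩
  set s : ℕ → ℝ≥0 := fun i => L.orderEmbOfFin rfl ⟨min i (L.card - 1), by omega⟩
  have hs : Monotone s := fun i j hij =>
    (L.orderEmbOfFin rfl).monotone (Fin.mk_le_mk.2 (min_le_min_right _ hij))
  have hmem : ∀ t ∈ L, ∃ k, s k = t := fun t ht => by
    have : t ∈ Set.range (L.orderEmbOfFin rfl) := by rw [Finset.range_orderEmbOfFin]; exact ht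
    obtain ⟨i, rfl⟩ := this
    refine ⟨i, congrArg _ (Fin.ext ?_)⟩
    have := i.2
    show min (i : ℕ) (L.card - 1) = i
    omega
  refine ⟨s, hs, ?_, fun t ht => hmem t (Finset.mem_insert_of_mem ht)⟩
  obtain ⟨k, hk⟩ := hmem 0 (Finset.mem_insert_self _ _)
  exact le_antisymm (hk ▸ hs (Nat.zero_le k)) zero_le

/-- The increments after time `t` are independent of the path up to time `t`. -/
lemma indepFun_past_increments [IsProbabilityMeasure P] (hX : IsSpectrallyNegativeLevy X P)
    (h0 : ∀ ω, X 0 ω = 0) (t : ℝ≥0) :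
    IndepFun (fun ω (s : Iic t) => X s ω) (fun ω u => X (t + u) ω - X t ω) P := by
  refine IndepFun.process_indepFun_process (X := fun (s : Iic t) ω => X s ω)
    (Y := fun u ω => X (t + u) ω - X t ω) (fun s => hX.measurable s)
    (fun u => (hX.measurable _).sub (hX.measurable _)) fun I J => ?_
  obtain ⟨s, hs, hs0, hsK⟩ :=
    exists_monotone_seq (insert t (I.image Subtype.val ∪ J.image (t + ·)))
  obtain ⟨m, hm⟩ := hsK t (by simp)
  have hI : ∀ i : I, ∃ k ≤ m, s k = i := fun i => by
    obtain ⟨k, hk⟩ := hsK i (by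
      refine Finset.mem_insert_of_mem (Finset.mem_union_left _ (Finset.mem_image_of_mem _ i.2)))
    refine ⟨min k m, min_le_right _ _, ?_⟩
    rw [hs.map_min, hk, hm]
    exact min_eq_left i.1.2
  have hJ : ∀ j : J, ∃ k, m ≤ k ∧ s k = t + j := fun j => by
    obtain ⟨k, hk⟩ := hsK (t + j) (by
      refine Finset.mem_insert_of_mem (Finset.mem_union_right _
        (Finset.mem_image_of_mem (t + ·) j.2)))
    refine ⟨max k m, le_max_right _ _, ?_⟩
    rw [hs.map_max, hk, hm]
    exact max_eq_left le_self_add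
  choose kI hkI hsI using hI
  choose kJ hkJ hsJ using hJ
  obtain ⟨N, hN⟩ := Finite.exists_le kJ
  have hind := iIndepFun.indepFun_finset (Finset.range m) (Finset.Ico m N)
    (by rw [Finset.range_eq_Ico]; exact Finset.Ico_disjoint_Ico_consecutive _ _ _)
    (hX.indep_increments.nat hs)
    (fun i => (hX.measurable _).sub (hX.measurable _))
  have hcomp := hind.comp
    (φ := fun x (i : I) => ∑ l : Finset.range m, if (l : ℕ) < kI i then x l else 0)
    (ψ := fun x (j : J) => ∑ l : Finset.Ico m N, if (l : ℕ) < kJ j then x l else 0)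
    (measurable_pi_lambda _ fun i => Finset.measurable_sum _ fun l _ => by
      split_ifs <;> fun_prop)
    (measurable_pi_lambda _ fun j => Finset.measurable_sum _ fun l _ => by
      split_ifs <;> fun_prop)
  convert hcomp using 1
  · ext ω i
    simp only [Function.comp]
    rw [Finset.sum_coe_sort (Finset.range m)
      (fun l => if l < kI i then X (s (l + 1)) ω - X (s l) ω else 0), ← Finset.sum_filter,
      show (Finset.range m).filter (· < kI i) = Finset.range (kI i) by
        ext l; have := hkI i; simp; omega,
      Finset.sum_range_sub (fun l => X (s l) ω), hsI, hs0, h0, sub_zero]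
  · ext ω j
    simp only [Function.comp]
    rw [Finset.sum_coe_sort (Finset.Ico m N)
      (fun l => if l < kJ j then X (s (l + 1)) ω - X (s l) ω else 0), ← Finset.sum_filter,
      show (Finset.Ico m N).filter (· < kJ j) = Finset.Ico m (kJ j) by
        ext l; have := hN j; simp; omega,
      Finset.sum_Ico_sub (fun l => X (s l) ω) (hkJ j), hsJ, hm]

/-- The increments after time `t` have the law of the process. -/
lemma map_increments_eq [IsProbabilityMeasure P] (hX : IsSpectrallyNegativeLevy X P)
    (h0 : ∀ ω, X 0 ω = 0) (t : ℝ≥0) :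
    P.map (fun ω u => X (t + u) ω - X t ω) = P.map (fun ω u => X u ω) := by
  refine (map_eq_iff_forall_finset_map_restrict_eq (X := fun u ω => X (t + u) ω - X t ω)
    (Y := X) ?_ ?_).2 fun I => ?_
  · exact (measurable_pi_lambda _ fun u =>
      (hX.measurable _).sub (hX.measurable _)).aemeasurable
  · exact (measurable_pi_lambda _ fun u => hX.measurable _).aemeasurable
  obtain ⟨s, hs, hs0, hsI⟩ := exists_monotone_seq I
  have hI : ∀ i : I, ∃ k, s k = i := fun i => hsI i i.2
  choose k hk using hI
  have hident := IdentDistrib.pi (μ := P) (ν := P)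
    (X := fun i ω => X (t + s (i + 1)) ω - X (t + s i) ω)
    (Y := fun i ω => X (s (i + 1)) ω - X (s i) ω) (fun i => ?_)
    (hX.indep_increments.nat (t := fun i => t + s i) fun i j hij =>
      add_le_add_right (hs hij) t) (hX.indep_increments.nat hs)
  · have hcomp := hident.comp (u := fun x (i : I) => ∑ l ∈ Finset.range (k i), x l)
      (measurable_pi_lambda _ fun i => Finset.measurable_sum _ fun l _ => measurable_pi_apply l)
    convert hcomp.map_eq using 2
    · ext ω i
      simp only [Function.comp, Finset.restrict]
      rw [Finset.sum_range_sub (fun l => X (t + s l) ω), hk, hs0, add_zero]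
    · ext ω i
      simp only [Function.comp, Finset.restrict]
      rw [Finset.sum_range_sub (fun l => X (s l) ω), hk, hs0, h0, sub_zero]
  · obtain ⟨d, hd⟩ := exists_add_of_le (hs (Nat.le_succ i))
    have h1 := hX.stationary_increments (t + s i) d
    have h2 := hX.stationary_increments (s i) d
    rw [add_assoc] at h1
    rw [← hd] at h1 h2
    exact h1.trans h2.symm

/-- Markov property: on an event determined by the path up to time `t`, a functional of the
increments after `t` integrates to the probability of the event times its mean. -/
lemma setLIntegral_increments [IsProbabilityMeasure P] (hX : IsSpectrallyNegativeLevy X P)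
    (h0 : ∀ ω, X 0 ω = 0) {t : ℝ≥0} {A : Set Ω} (hA : MeasurableSet[past X t] A)
    {H : (ℝ≥0 → ℝ) → ℝ≥0∞} (hH : Measurable H) :
    ∫⁻ ω in A, H (fun u => X (t + u) ω - X t ω) ∂P = P A * ∫⁻ ω, H (fun u => X u ω) ∂P := by
  have hm : Measurable (fun ω u => X (t + u) ω - X t ω) :=
    measurable_pi_lambda _ fun u => (hX.measurable _).sub (hX.measurable _)
  have hA' : MeasurableSet A := past_le hX.measurable t _ hA
  have hind : Indep (past X t) (MeasurableSpace.comap (fun ω u => X (t + u) ω - X t ω)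
      inferInstance) P := indepFun_past_increments hX h0 t
  have hi : Measurable[past X t] (A.indicator (1 : Ω → ℝ≥0∞)) := by
    refine @Measurable.indicator Ω ℝ≥0∞ A 1 (past X t) _ _ ?_ hA
    exact @measurable_const _ _ _ (past X t) 1
  have h1 := lintegral_mul_eq_lintegral_mul_lintegral_of_independent_measurableSpace
    (past_le hX.measurable t) hm.comap_le hind (f := A.indicator 1)
    (g := fun ω => H (fun u => X (t + u) ω - X t ω))
    hi (hH.comp (comap_measurable _))
  rw [← lintegral_indicator hA']
  have h2 : ∫⁻ ω, H (fun u => X (t + u) ω - X t ω) ∂P = ∫⁻ ω, H (fun u => X u ω) ∂P := by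
    rw [← lintegral_map hH hm, map_increments_eq hX h0 t,
      lintegral_map hH (measurable_pi_lambda _ fun u => hX.measurable _)]
  rw [lintegral_indicator_one hA', h2] at h1
  rw [← h1]
  refine lintegral_congr fun ω => ?_
  by_cases h : ω ∈ A <;> simp [h]

end Markov

/-! ### The strong Markov property -/

/-- The smallest multiple of `1 / (n + 1)` that is greater than `s`. -/
noncomputable def gridAbove (n : ℕ) (s : ℝ≥0) : ℝ≥0 := (⌊s * (n + 1)⌋₊ + 1) / (n + 1)

lemma lt_gridAbove (n : ℕ) (s : ℝ≥0) : s < gridAbove n s := by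
  rw [gridAbove, lt_div_iff₀ (by positivity)]
  exact Nat.lt_floor_add_one _

lemma gridAbove_le (n : ℕ) (s : ℝ≥0) : gridAbove n s ≤ s + 1 / (n + 1) := by
  rw [gridAbove, add_div]
  gcongr
  rw [div_le_iff₀ (by positivity)]
  exact Nat.floor_le zero_le

lemma tendsto_gridAbove (s : ℝ≥0) : Tendsto (fun n => gridAbove n s) atTop (𝓝[≥] s) := by
  refine tendsto_nhdsWithin_iff.2 ⟨?_, Eventually.of_forall fun n => (lt_gridAbove n s).le⟩
  have h1 : Tendsto (fun n : ℕ => s + 1 / ((n : ℝ≥0) + 1)) atTop (𝓝 (s + 0)) :=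
    tendsto_const_nhds.add tendsto_one_div_add_atTop_nhds_zero_nat
  rw [add_zero] at h1
  exact tendsto_of_tendsto_of_tendsto_of_le_of_le tendsto_const_nhds h1
    (fun n => (lt_gridAbove n s).le) fun n => gridAbove_le n s

lemma measurable_gridAbove (n : ℕ) : Measurable (gridAbove n) := by
  have : Measurable fun s : ℝ≥0 => ⌊s * (n + 1)⌋₊ :=
    Nat.measurable_floor.comp (measurable_id.mul_const _)
  exact ((measurable_from_top (f := fun k : ℕ => (k : ℝ≥0))).comp this |>.add_const 1).div_const _

/-- A random time `τ` with `{τ < t}` determined by the path up to time `t`, for every `t`. -/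
def IsOptionalTime {Ω : Type*} (X : ℝ≥0 → Ω → ℝ) (τ : Ω → WithTop ℝ≥0) : Prop :=
  ∀ t : ℝ≥0, MeasurableSet[past X t] {ω | τ ω < t}

section StrongMarkov

variable {Ω : Type*} [MeasurableSpace Ω] {X : ℝ≥0 → Ω → ℝ} {P : Measure Ω}

lemma measurable_of_forall_measurableSet_lt {τ : Ω → WithTop ℝ≥0}
    (h : ∀ t : ℝ≥0, MeasurableSet {ω | τ ω < t}) : Measurable τ := by
  refine measurable_of_Iio fun x => ?_
  induction x using WithTop.recTopCoe with
  | coe t => exact h t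
  | top =>
    have : τ ⁻¹' Iio ⊤ = ⋃ n : ℕ, {ω | τ ω < ((n : ℝ≥0) : WithTop ℝ≥0)} := by
      ext ω
      simp only [mem_preimage, mem_Iio, mem_iUnion]
      refine ⟨fun h => ?_, fun ⟨n, hn⟩ => lt_of_lt_of_le hn le_top⟩
      obtain ⟨t, ht⟩ := WithTop.ne_top_iff_exists.1 h.ne
      obtain ⟨n, hn⟩ := exists_nat_gt t
      refine ⟨n, ?_⟩
      show τ ω < _
      rw [← ht]; exact WithTop.coe_lt_coe.2 hn
    rw [this]
    exact MeasurableSet.iUnion fun n => h n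

lemma IsOptionalTime.measurable {τ : Ω → WithTop ℝ≥0} (hτ : IsOptionalTime X τ)
    (hX : ∀ t, Measurable (X t)) : Measurable τ :=
  measurable_of_forall_measurableSet_lt fun t => past_le hX t _ (hτ t)

lemma measurable_discount (r : ℝ) : Measurable (discount r) := by
  refine WithTop.measurable_of_measurable_comp_coe ?_
  simp_rw [discount_coe]
  fun_prop

/-- Right-continuity of the paths makes the process jointly measurable, so that its value at a
random time is measurable. -/
lemma measurable_eval (hX : ∀ t, Measurable (X t))
    (hreg : ∀ ω, IsRegularPath fun t => X t ω) {T : Ω → ℝ≥0} (hT : Measurable T) :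
    Measurable fun ω => X (T ω) ω := by
  refine measurable_of_tendsto_metrizable (f := fun n ω => X (gridAbove n (T ω)) ω)
    (fun n => ?_) (tendsto_pi_nhds.2 fun ω =>
      ((hreg ω).right_continuous (T ω)).tendsto.comp (tendsto_gridAbove (T ω)))
  have h1 : Measurable fun p : ℕ × Ω => X (((p.1 : ℝ≥0) + 1) / (n + 1)) p.2 := by
    refine measurable_from_prod_countable_right fun k => ?_
    exact hX (((k : ℝ≥0) + 1) / (n + 1))
  have h2 : Measurable fun ω => (⌊T ω * (n + 1)⌋₊, ω) :=
    (Nat.measurable_floor.comp (hT.mul_const _)).prodMk measurable_id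
  have h3 := h1.comp h2
  simp only [Function.comp_def] at h3
  simpa only [gridAbove] using h3

lemma measurable_shift (hX : ∀ t, Measurable (X t))
    (hreg : ∀ ω, IsRegularPath fun t => X t ω) {T : Ω → ℝ≥0} (hT : Measurable T) :
    Measurable fun ω u => shift X T u ω :=
  measurable_pi_lambda _ fun u =>
    (measurable_eval hX hreg (hT.add_const u)).sub (measurable_eval hX hreg hT)

lemma lintegral_discount_mul_shift_gridAbove [IsProbabilityMeasure P]
    (hX : IsSpectrallyNegativeLevy X P) (hreg : ∀ ω, IsRegularPath fun t => X t ω)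
    {τ : Ω → WithTop ℝ≥0} (hτ : IsOptionalTime X τ) (r : ℝ) (n : ℕ)
    {H : (ℝ≥0 → ℝ) → ℝ≥0∞} (hH : Measurable H) :
    ∫⁻ ω, ENNReal.ofReal (discount r ((τ ω).map (gridAbove n))) *
        H (fun u => shift X (fun ω => gridAbove n ((τ ω).untopD 0)) u ω) ∂P =
      (∫⁻ ω, ENNReal.ofReal (discount r ((τ ω).map (gridAbove n))) ∂P) *
        ∫⁻ ω, H (fun u => X u ω) ∂P := by
  set g : ℕ → ℝ≥0 := fun k => k / (n + 1) with hg
  set A : ℕ → Set Ω := fun k => {ω | τ ω < g (k + 1)} \ {ω | τ ω < g k} with hA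
  have hAiff : ∀ k ω, ω ∈ A k ↔ ∃ t : ℝ≥0, τ ω = t ∧ ⌊t * (n + 1)⌋₊ = k := by
    intro k ω
    rw [hA]
    simp only [Set.mem_sdiff, mem_ofPred_eq, not_lt]
    constructor
    · rintro ⟨h1, h2⟩
      obtain ⟨t, ht⟩ := WithTop.ne_top_iff_exists.1 h1.ne_top
      rw [← ht] at h1 h2
      have h1' : t < g (k + 1) := WithTop.coe_lt_coe.1 h1
      have h2' : g k ≤ t := WithTop.coe_le_coe.1 h2
      refine ⟨t, ht.symm, (Nat.floor_eq_iff zero_le).2 ⟨?_, ?_⟩⟩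
      · rwa [hg, div_le_iff₀ (by positivity)] at h2'
      · rw [hg, lt_div_iff₀ (by positivity)] at h1'
        exact_mod_cast h1'
    · rintro ⟨t, ht, hk⟩
      rw [Nat.floor_eq_iff zero_le] at hk
      rw [ht]
      refine ⟨WithTop.coe_lt_coe.2 ?_, WithTop.coe_le_coe.2 ?_⟩
      · rw [hg, lt_div_iff₀ (by positivity)]; exact_mod_cast hk.2
      · rw [hg, div_le_iff₀ (by positivity)]; exact hk.1
  have hAmeas : ∀ k, MeasurableSet[past X (g (k + 1))] (A k) := fun k =>
    (hτ _).diff (past_mono X (by simp only [hg]; gcongr; simp) _ (hτ (g k)))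
  have hAmeas' : ∀ k, MeasurableSet (A k) := fun k => past_le hX.measurable _ _ (hAmeas k)
  have hdisj : Pairwise (Function.onFun Disjoint A) := fun i j hij => by
    refine Set.disjoint_left.2 fun ω h1 h2 => hij ?_
    obtain ⟨t, ht, h1⟩ := (hAiff i ω).1 h1
    obtain ⟨t', ht', h2⟩ := (hAiff j ω).1 h2
    obtain rfl : t = t' := WithTop.coe_injective (ht.symm.trans ht')
    exact h1.symm.trans h2
  have hsum : ∀ φ : Ω → ℝ≥0∞, (∀ ω, τ ω = ⊤ → φ ω = 0) →
      ∫⁻ ω, φ ω ∂P = ∑' k, ∫⁻ ω in A k, φ ω ∂P := fun φ hφ => by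
    rw [← lintegral_iUnion hAmeas' hdisj, ← lintegral_indicator (MeasurableSet.iUnion hAmeas')]
    refine lintegral_congr fun ω => ?_
    by_cases h : τ ω = ⊤
    · rw [hφ ω h]; by_cases h' : ω ∈ ⋃ k, A k <;> simp [h', hφ ω h]
    · obtain ⟨t, ht⟩ := WithTop.ne_top_iff_exists.1 h
      rw [indicator_of_mem]
      exact mem_iUnion.2 ⟨_, (hAiff _ ω).2 ⟨t, ht.symm, rfl⟩⟩
  have hval : ∀ k ω, ω ∈ A k → discount r ((τ ω).map (gridAbove n)) = discount r (g (k + 1)) ∧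
      gridAbove n ((τ ω).untopD 0) = g (k + 1) := fun k ω h => by
    obtain ⟨t, ht, hk⟩ := (hAiff k ω).1 h
    have : gridAbove n t = g (k + 1) := by simp [gridAbove, hg, hk]
    rw [ht, WithTop.map_coe, WithTop.untopD_coe, this]
    exact ⟨rfl, rfl⟩
  rw [hsum _ fun ω h => by simp [h, discount_top], hsum _ fun ω h => by simp [h, discount_top],
    ← ENNReal.tsum_mul_right]
  refine tsum_congr fun k => ?_
  have h1 := setLIntegral_increments hX (fun ω => (hreg ω).zero) (hAmeas k) hH
  have hmeas : Measurable fun ω => H (fun u => X (g (k + 1) + u) ω - X (g (k + 1)) ω) :=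
    hH.comp (measurable_pi_lambda _ fun u => (hX.measurable _).sub (hX.measurable _))
  calc _ = ∫⁻ ω in A k, ENNReal.ofReal (discount r (g (k + 1))) *
        H (fun u => X (g (k + 1) + u) ω - X (g (k + 1)) ω) ∂P :=
        setLIntegral_congr_fun (hAmeas' k) fun ω h => by
          simp only [shift, (hval k ω h).1, (hval k ω h).2]
    _ = ENNReal.ofReal (discount r (g (k + 1))) * P (A k) * ∫⁻ ω, H (fun u => X u ω) ∂P := by
        rw [lintegral_const_mul _ hmeas, h1, mul_assoc]
    _ = (∫⁻ ω in A k, ENNReal.ofReal (discount r (g (k + 1))) ∂P) *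
        ∫⁻ ω, H (fun u => X u ω) ∂P := by rw [setLIntegral_const]
    _ = _ := by
        congr 1
        exact setLIntegral_congr_fun (hAmeas' k) fun ω h => by simp only [(hval k ω h).1]

/-- Strong Markov property at an optional time: after discounting, the process of increments after
`τ` is independent of `τ` and has the law of `X`. The time is approximated from the right by times
with values in a grid, and right-continuity identifies the finite-dimensional laws in the limit. -/
theorem lintegral_discount_mul_shift [IsProbabilityMeasure P]
    (hX : IsSpectrallyNegativeLevy X P) (hreg : ∀ ω, IsRegularPath fun t => X t ω)
    {τ : Ω → WithTop ℝ≥0} (hτ : IsOptionalTime X τ) {r : ℝ} (hr : 0 ≤ r)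
    {H : (ℝ≥0 → ℝ) → ℝ≥0∞} (hH : Measurable H) :
    ∫⁻ ω, ENNReal.ofReal (discount r (τ ω)) *
        H (fun u => shift X (fun ω => (τ ω).untopD 0) u ω) ∂P =
      (∫⁻ ω, ENNReal.ofReal (discount r (τ ω)) ∂P) * ∫⁻ ω, H (fun u => X u ω) ∂P := by
  have hτm := hτ.measurable hX.measurable
  have hT : Measurable fun ω => (τ ω).untopD 0 := hτm.untopD 0
  have hw : Measurable fun ω => ENNReal.ofReal (discount r (τ ω)) :=
    ((measurable_discount r).comp hτm).ennreal_ofReal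
  have hsh := measurable_shift hX.measurable hreg hT
  have hpath : Measurable fun ω u => X u ω := measurable_pi_lambda _ hX.measurable
  have hw1 : ∀ t, ENNReal.ofReal (discount r t) ≤ 1 := fun t =>
    ENNReal.ofReal_le_one.2 (discount_le_one hr t)
  have hwfin : ∫⁻ ω, ENNReal.ofReal (discount r (τ ω)) ∂P ≠ ∞ :=
    ((lintegral_mono fun ω => hw1 (τ ω)).trans_lt (by simp)).ne
  set μ := P.withDensity fun ω => ENNReal.ofReal (discount r (τ ω)) with hμ
  have : IsFiniteMeasure μ := isFiniteMeasure_withDensity hwfin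
  set c := ∫⁻ ω, ENNReal.ofReal (discount r (τ ω)) ∂P with hc
  -- convergence of the discretised functionals, for functionals of finitely many coordinates
  have hlim : ∀ (I : Finset ℝ≥0) (f : BoundedContinuousFunction (I → ℝ) ℝ≥0),
      ∫⁻ ω, ENNReal.ofReal (discount r (τ ω)) *
        f (I.restrict fun u => shift X (fun ω => (τ ω).untopD 0) u ω) ∂P =
      c * ∫⁻ ω, f (I.restrict fun u => X u ω) ∂P := by
    intro I f
    have hconvw : ∀ ω, Tendsto (fun n => ENNReal.ofReal (discount r ((τ ω).map (gridAbove n))))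
        atTop (𝓝 (ENNReal.ofReal (discount r (τ ω)))) := fun ω => by
      refine ENNReal.tendsto_ofReal ?_
      cases h : τ ω with
      | top => simp
      | coe t =>
        simp only [WithTop.map_coe, discount_coe]
        have h1 : Tendsto (fun n => (gridAbove n t : ℝ)) atTop (𝓝 (t : ℝ)) :=
          NNReal.tendsto_coe.2 ((tendsto_gridAbove t).mono_right nhdsWithin_le_nhds)
        exact (Real.continuous_exp.tendsto _).comp (h1.const_mul r).neg
    have hconvX : ∀ ω, Tendsto (fun n => (f (I.restrict fun u =>
        shift X (fun ω => gridAbove n ((τ ω).untopD 0)) u ω) : ℝ≥0∞)) atTop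
        (𝓝 (f (I.restrict fun u => shift X (fun ω => (τ ω).untopD 0) u ω))) := fun ω => by
      refine ENNReal.tendsto_coe.2 ((f.continuous.tendsto _).comp (tendsto_pi_nhds.2 fun u => ?_))
      have h1 := tendsto_gridAbove ((τ ω).untopD 0)
      have h2 : Tendsto (fun n => gridAbove n ((τ ω).untopD 0) + u) atTop
          (𝓝[≥] ((τ ω).untopD 0 + u)) := by
        rw [tendsto_nhdsWithin_iff] at h1 ⊢
        refine ⟨h1.1.add_const _, h1.2.mono fun n hn => ?_⟩
        exact add_le_add_left (mem_Ici.1 hn) _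
      exact (((hreg ω).right_continuous _).tendsto.comp h2).sub
        (((hreg ω).right_continuous _).tendsto.comp h1)
    have hmeasw : ∀ n, Measurable fun ω =>
        ENNReal.ofReal (discount r ((τ ω).map (gridAbove n))) := fun n =>
      ((measurable_discount r).comp ((WithTop.measurable_of_measurable_comp_coe
        (f := WithTop.map (gridAbove n)) (by
          simp only [WithTop.map_coe]
          exact (measurable_gridAbove n).withTop_coe)).comp hτm)).ennreal_ofReal
    have hmeasf : Measurable fun x : ℝ≥0 → ℝ => (f (I.restrict x) : ℝ≥0∞) :=
      (f.continuous.measurable.comp (Finset.measurable_restrict I)).coe_nnreal_ennreal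
    obtain ⟨C, hbound⟩ : ∃ C : ℝ≥0, ∀ x, (f x : ℝ≥0∞) ≤ C := ⟨nndist f 0, fun x => by
      have h : f x ≤ nndist f 0 := by
        simpa using BoundedContinuousFunction.nndist_coe_le_nndist (f := f) (g := 0) x
      exact ENNReal.coe_le_coe.2 h⟩
    have hA := tendsto_lintegral_of_dominated_convergence (μ := P)
      (F := fun n ω => ENNReal.ofReal (discount r ((τ ω).map (gridAbove n))) *
        f (I.restrict fun u => shift X (fun ω => gridAbove n ((τ ω).untopD 0)) u ω))
      (f := fun ω => ENNReal.ofReal (discount r (τ ω)) *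
        f (I.restrict fun u => shift X (fun ω => (τ ω).untopD 0) u ω))
      (fun _ => (C : ℝ≥0∞))
      (fun n => (hmeasw n).mul (hmeasf.comp (measurable_shift hX.measurable hreg
        ((measurable_gridAbove n).comp hT))))
      (fun n => Eventually.of_forall fun ω => by
        calc _ ≤ 1 * (C : ℝ≥0∞) := mul_le_mul' (hw1 _) (hbound _)
          _ = _ := one_mul _)
      (by simp)
      (Eventually.of_forall fun ω => ENNReal.Tendsto.mul (hconvw ω)
        (Or.inr (by simp)) (hconvX ω) (Or.inr (by
          exact (lt_of_le_of_lt (hw1 (τ ω)) (by simp)).ne)))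
    have hB := tendsto_lintegral_of_dominated_convergence (μ := P)
      (F := fun n ω => ENNReal.ofReal (discount r ((τ ω).map (gridAbove n))))
      (f := fun ω => ENNReal.ofReal (discount r (τ ω)))
      (fun _ => 1) hmeasw (fun n => Eventually.of_forall fun ω => hw1 _) (by simp)
      (Eventually.of_forall hconvw)
    have hfin : ∫⁻ ω, f (I.restrict fun u => X u ω) ∂P ≠ ∞ :=
      ((lintegral_mono fun ω => hbound _).trans_lt (by simp)).ne
    refine tendsto_nhds_unique hA ?_
    have hC := ENNReal.Tendsto.mul_const hB
      (b := ∫⁻ ω, f (I.restrict fun u => X u ω) ∂P) (Or.inr hfin)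
    refine hC.congr fun n => ?_
    exact (lintegral_discount_mul_shift_gridAbove hX hreg hτ r n
      (H := fun x => (f (I.restrict x) : ℝ≥0∞)) hmeasf).symm
  have hlaw : μ.map (fun ω u => shift X (fun ω => (τ ω).untopD 0) u ω) =
      c • P.map (fun ω u => X u ω) := by
    have : IsFiniteMeasure (c • P.map (fun ω u => X u ω)) :=
      ⟨by simpa [lt_top_iff_ne_top] using ENNReal.mul_ne_top hwfin (measure_ne_top _ _)⟩
    refine IsProjectiveLimit.unique
      (P := fun I => (c • P.map (fun ω u => X u ω)).map I.restrict) (fun I => ?_) (fun I => rfl)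
    refine ext_of_forall_lintegral_eq_of_IsFiniteMeasure fun f => ?_
    have hf : Measurable fun x : I → ℝ => (f x : ℝ≥0∞) :=
      f.continuous.measurable.coe_nnreal_ennreal
    have hr' := Finset.measurable_restrict (X := fun _ : ℝ≥0 => ℝ) I
    have hfr : Measurable fun x : ℝ≥0 → ℝ => (f (I.restrict x) : ℝ≥0∞) := hf.comp hr'
    have hfs : Measurable fun ω =>
        (f (I.restrict fun u => shift X (fun ω => (τ ω).untopD 0) u ω) : ℝ≥0∞) := hfr.comp hsh
    beta_reduce
    rw [lintegral_map hf hr', lintegral_map hfr hsh, lintegral_map hf hr',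
      lintegral_smul_measure, lintegral_map hfr hpath, hμ,
      lintegral_withDensity_eq_lintegral_mul _ hw hfs]
    exact hlim I f
  have hHs : Measurable fun ω => H (fun u => shift X (fun ω => (τ ω).untopD 0) u ω) :=
    hH.comp hsh
  calc _ = ∫⁻ ω, H (fun u => shift X (fun ω => (τ ω).untopD 0) u ω) ∂μ := by
        rw [hμ, lintegral_withDensity_eq_lintegral_mul _ hw hHs]; rfl
    _ = ∫⁻ x, H x ∂(c • P.map (fun ω u => X u ω)) := by rw [← hlaw, lintegral_map hH hsh]
    _ = _ := by rw [lintegral_smul_measure, lintegral_map hH hpath]; rfl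

end StrongMarkov

/-! ### Measurability of the drawdown time -/

section DrawdownTime

variable {Ω : Type*} {X : ℝ≥0 → Ω → ℝ}

lemma isOptionalTime_timeAbove {Y : ℝ≥0 → Ω → ℝ} (c : ℝ)
    (hY : ∀ ω t, ContinuousWithinAt (fun s => Y s ω) (Ici t) t)
    (husc : ∀ ω t, ∀ c, Y t ω < c → ∀ᶠ s in 𝓝 t, Y s ω < c)
    (hm : ∀ k c, MeasurableSet[past X (denseSeq ℝ≥0 k)] {ω | c < Y (denseSeq ℝ≥0 k) ω}) :
    IsOptionalTime X (timeAbove Y c) := by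
  intro t
  have : {ω | timeAbove Y c ω < t} = ⋃ k, ⋃ (_ : denseSeq ℝ≥0 k < t), ⋂ n : ℕ, ⋃ j,
      ⋃ (_ : denseSeq ℝ≥0 j ≤ denseSeq ℝ≥0 k),
        {ω | c - 1 / (n + 1) < Y (denseSeq ℝ≥0 j) ω} := by
    ext ω
    rw [mem_ofPred_eq, timeAbove_lt_iff_denseSeq (hY ω) (husc ω)]
    simp
  rw [this]
  refine MeasurableSet.iUnion fun k => MeasurableSet.iUnion fun hk => MeasurableSet.iInter fun n =>
    MeasurableSet.iUnion fun j => MeasurableSet.iUnion fun hj => ?_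
  exact past_mono X (hj.trans hk.le) _ (hm j _)

lemma lt_drawdown_denseSeq_iff {ω : Ω} (hω : IsRegularPath fun t => X t ω) {y c : ℝ} {k : ℕ} :
    c < drawdown X y (denseSeq ℝ≥0 k) ω ↔ c < y - X (denseSeq ℝ≥0 k) ω ∨
      ∃ j, denseSeq ℝ≥0 j ≤ denseSeq ℝ≥0 k ∧
        c < X (denseSeq ℝ≥0 j) ω - X (denseSeq ℝ≥0 k) ω := by
  rw [lt_drawdown_iff hω]
  refine or_congr_right ⟨?_, fun ⟨j, hj, h⟩ => ⟨_, hj, h⟩⟩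
  rintro ⟨s, hs, h⟩
  rcases eq_or_lt_of_le hs with rfl | hlt
  · exact ⟨k, le_rfl, h⟩
  · obtain ⟨j, -, hj, h⟩ := exists_denseSeq_of_right_continuous (hω.right_continuous s)
      (p := fun x => c + X (denseSeq ℝ≥0 k) ω < x) (eventually_gt_nhds (by linarith)) hlt
    exact ⟨j, hj.le, by linarith⟩

lemma isOptionalTime_τD (hreg : ∀ ω, IsRegularPath fun t => X t ω) (y a : ℝ) :
    IsOptionalTime X (τD X y a) := by
  refine isOptionalTime_timeAbove a (fun ω => drawdown_right_continuous (hreg ω) y)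
    (fun ω t c hc => drawdown_eventually_lt (hreg ω) hc) fun k c => ?_
  have hX := fun j (hj : denseSeq ℝ≥0 j ≤ denseSeq ℝ≥0 k) => measurable_past X hj
  have : {ω | c < drawdown X y (denseSeq ℝ≥0 k) ω} = {ω | c < y - X (denseSeq ℝ≥0 k) ω} ∪
      ⋃ j, ⋃ (_ : denseSeq ℝ≥0 j ≤ denseSeq ℝ≥0 k),
        {ω | c < X (denseSeq ℝ≥0 j) ω - X (denseSeq ℝ≥0 k) ω} := by
    ext ω
    rw [mem_ofPred_eq, lt_drawdown_denseSeq_iff (hreg ω)]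
    simp
  rw [this]
  refine MeasurableSet.union ?_ (MeasurableSet.iUnion fun j => MeasurableSet.iUnion fun hj => ?_)
  · exact (Measurable.const_sub (hX k le_rfl) y) measurableSet_Ioi
  · exact (Measurable.sub (hX j hj) (hX k le_rfl)) measurableSet_Ioi

lemma isOptionalTime_timeAbove_neg (hreg : ∀ ω, IsRegularPath fun t => X t ω) (c : ℝ) :
    IsOptionalTime X (timeAbove (fun t ω => -X t ω) c) := by
  refine isOptionalTime_timeAbove c (fun ω t => ((hreg ω).right_continuous t).neg)
    (fun ω t c hc => ?_) fun k c => ?_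
  · filter_upwards [(hreg ω).eventually_gt (c := -c) (t := t) (by linarith)] with s hs
    linarith
  · exact (Measurable.neg (measurable_past X le_rfl)) measurableSet_Ioi

end DrawdownTime

/-! ### Approximation of the drawup time from below -/

/-- The first time at which the drawup of `f` exceeds `c`, computed along the countable dense set,
so that it depends measurably on an arbitrary `f`. -/
noncomputable def excessTime (c z : ℝ) (f : ℝ≥0 → ℝ) : WithTop ℝ≥0 :=
  ⨅ k, ⨅ (_ : c < f (denseSeq ℝ≥0 k) + z ∨ ∃ j, denseSeq ℝ≥0 j ≤ denseSeq ℝ≥0 k ∧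
    c < f (denseSeq ℝ≥0 k) - f (denseSeq ℝ≥0 j)), ((denseSeq ℝ≥0 k : ℝ≥0) : WithTop ℝ≥0)

/-- The limit of the times at which the drawup exceeds levels increasing to `b`. Unlike the hitting
time of `b` itself it is a measurable functional of the path. -/
noncomputable def approachTime (b z : ℝ) (f : ℝ≥0 → ℝ) : WithTop ℝ≥0 :=
  ⨆ n : ℕ, excessTime (b - 1 / (n + 1)) z f

lemma excessTime_lt_coe_iff {c z : ℝ} {f : ℝ≥0 → ℝ} {t : ℝ≥0} : excessTime c z f < t ↔
    ∃ k, denseSeq ℝ≥0 k < t ∧ (c < f (denseSeq ℝ≥0 k) + z ∨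
      ∃ j, denseSeq ℝ≥0 j ≤ denseSeq ℝ≥0 k ∧
        c < f (denseSeq ℝ≥0 k) - f (denseSeq ℝ≥0 j)) := by
  simp only [excessTime, iInf_lt_iff, WithTop.coe_lt_coe, exists_prop]
  exact exists_congr fun k => and_comm

lemma excessTime_mono {c c' z : ℝ} (h : c ≤ c') (f : ℝ≥0 → ℝ) :
    excessTime c z f ≤ excessTime c' z f :=
  iInf_mono fun _ => iInf_mono' fun h' => ⟨h'.imp (lt_of_le_of_lt h)
    fun ⟨j, hj, hc⟩ => ⟨j, hj, lt_of_le_of_lt h hc⟩, le_rfl⟩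

lemma excessTime_seq_mono (b z : ℝ) (f : ℝ≥0 → ℝ) :
    Monotone fun n : ℕ => excessTime (b - 1 / (n + 1)) z f := fun m n h =>
  excessTime_mono (sub_le_sub_left (one_div_le_one_div_of_le (by positivity)
    (by have : (m : ℝ) ≤ n := Nat.cast_le.2 h
        linarith)) b) f

lemma measurableSet_excessTime_lt {Ω : Type*} [MeasurableSpace Ω] {Y : ℝ≥0 → Ω → ℝ} {t : ℝ≥0}
    (hY : ∀ s ≤ t, Measurable (Y s)) (c z : ℝ) :
    MeasurableSet {ω | excessTime c z (fun s => Y s ω) < t} := by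
  have : {ω | excessTime c z (fun s => Y s ω) < t} = ⋃ k, ⋃ (_ : denseSeq ℝ≥0 k < t),
      ({ω | c < Y (denseSeq ℝ≥0 k) ω + z} ∪ ⋃ j, ⋃ (_ : denseSeq ℝ≥0 j ≤ denseSeq ℝ≥0 k),
        {ω | c < Y (denseSeq ℝ≥0 k) ω - Y (denseSeq ℝ≥0 j) ω}) := by
    ext ω
    rw [mem_ofPred_eq, excessTime_lt_coe_iff]
    simp
  rw [this]
  refine MeasurableSet.iUnion fun k => MeasurableSet.iUnion fun hk => MeasurableSet.union ?_
    (MeasurableSet.iUnion fun j => MeasurableSet.iUnion fun hj => ?_)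
  · exact measurableSet_lt measurable_const ((hY _ hk.le).add_const z)
  · exact measurableSet_lt measurable_const ((hY _ hk.le).sub (hY _ (hj.trans hk.le)))

lemma isOptionalTime_excessTime {Ω : Type*} (X : ℝ≥0 → Ω → ℝ) (c z : ℝ) :
    IsOptionalTime X fun ω => excessTime c z fun s => X s ω := fun t =>
  @measurableSet_excessTime_lt Ω (past X t) X t (fun _ hs => measurable_past X hs) c z

lemma approachTime_lt_coe_iff {b z : ℝ} {f : ℝ≥0 → ℝ} {t : ℝ≥0} : approachTime b z f < t ↔
    ∃ k, denseSeq ℝ≥0 k < t ∧ ∀ n : ℕ, excessTime (b - 1 / (n + 1)) z f < denseSeq ℝ≥0 k := by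
  constructor
  · intro h
    obtain ⟨u, hu⟩ := WithTop.ne_top_iff_exists.1 h.ne_top
    rw [← hu] at h
    obtain ⟨k, h1, h2⟩ := exists_denseSeq_between (WithTop.coe_lt_coe.1 h)
    refine ⟨k, h2, fun n => (le_iSup (fun n : ℕ => excessTime (b - 1 / (n + 1)) z f) n).trans_lt ?_⟩
    change approachTime b z f < _
    rw [← hu]
    exact WithTop.coe_lt_coe.2 h1
  · rintro ⟨k, hk, h⟩
    exact (iSup_le fun n => (h n).le).trans_lt (WithTop.coe_lt_coe.2 hk)

lemma isOptionalTime_approachTime {Ω : Type*} (X : ℝ≥0 → Ω → ℝ) (b z : ℝ) :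
    IsOptionalTime X fun ω => approachTime b z fun s => X s ω := by
  intro t
  have : {ω | approachTime b z (fun s => X s ω) < t} = ⋃ k, ⋃ (_ : denseSeq ℝ≥0 k < t),
      ⋂ n : ℕ, {ω | excessTime (b - 1 / (n + 1)) z (fun s => X s ω) < denseSeq ℝ≥0 k} := by
    ext ω
    rw [mem_ofPred_eq, approachTime_lt_coe_iff]
    simp
  rw [this]
  refine MeasurableSet.iUnion fun k => MeasurableSet.iUnion fun hk => MeasurableSet.iInter fun n =>
    ?_
  exact past_mono X hk.le _ (isOptionalTime_excessTime X _ z _)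

lemma measurable_approachTime (b z : ℝ) : Measurable (approachTime b z) :=
  Measurable.iSup fun _ => measurable_of_forall_measurableSet_lt fun _ =>
    measurableSet_excessTime_lt (Y := fun s (f : ℝ≥0 → ℝ) => f s)
      (fun s _ => measurable_pi_apply s) _ z

section Path

variable {Ω : Type*} {X : ℝ≥0 → Ω → ℝ} {ω : Ω} {b c z : ℝ}

lemma le_coe_of_forall_lt_coe {x : WithTop ℝ≥0} {t : ℝ≥0}
    (h : ∀ u : ℝ≥0, t < u → x < u) : x ≤ t := by
  by_contra! hn
  obtain ⟨u, h1, h2⟩ := exists_between hn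
  obtain ⟨v, rfl⟩ := WithTop.ne_top_iff_exists.1 h2.ne_top
  exact lt_irrefl _ ((h v (WithTop.coe_lt_coe.1 h1)).trans h2)

variable (hω : IsRegularPath fun t => X t ω)
include hω

lemma excessTime_lt_coe_iff_drawup {t : ℝ≥0} : excessTime c z (fun s => X s ω) < t ↔
    ∃ s < t, c < drawup X z s ω := by
  rw [excessTime_lt_coe_iff]
  constructor
  · rintro ⟨k, hk, h⟩
    refine ⟨_, hk, (lt_drawup_iff hω).2 (h.imp_right fun ⟨j, hj, h⟩ => ⟨_, hj, h⟩)⟩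
  · rintro ⟨s, hs, h⟩
    obtain ⟨k, -, hk, h⟩ := exists_denseSeq_of_right_continuous (drawup_right_continuous hω z s)
      (p := fun x => c < x) (eventually_gt_nhds h) hs
    refine ⟨k, hk, ((lt_drawup_iff hω).1 h).imp_right ?_⟩
    rintro ⟨u, hu, h⟩
    rcases eq_or_lt_of_le hu with rfl | hlt
    · exact ⟨k, le_rfl, h⟩
    · obtain ⟨j, -, hj, h⟩ := exists_denseSeq_of_right_continuous (hω.right_continuous u)
        (p := fun x => x < X (denseSeq ℝ≥0 k) ω - c) (eventually_lt_nhds (by linarith)) hlt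
      exact ⟨j, hj.le, by linarith⟩

lemma le_drawup_of_excessTime_eq {t : ℝ≥0} (h : excessTime c z (fun s => X s ω) = t) :
    c ≤ drawup X z t ω := by
  by_contra! hn
  obtain ⟨u, hu, hlt⟩ := exists_Ico_forall_of_continuousWithinAt (drawup_right_continuous hω z t)
    (p := fun x => x < c) (eventually_lt_nhds hn)
  obtain ⟨s, hs, hc⟩ := (excessTime_lt_coe_iff_drawup hω (c := c) (z := z) (t := u)).1
    (h ▸ WithTop.coe_lt_coe.2 hu)
  rcases lt_or_ge s t with hst | hst
  · exact absurd h ((excessTime_lt_coe_iff_drawup hω).2 ⟨s, hst, hc⟩).ne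
  · exact lt_asymm (hlt s hst hs) hc

lemma excessTime_le_τU (hc : c < b) : excessTime c z (fun s => X s ω) ≤ τU X z b ω := by
  by_cases h : τU X z b ω = ⊤
  · rw [h]; exact le_top
  obtain ⟨t, ht⟩ := WithTop.ne_top_iff_exists.1 h
  rw [← ht]
  refine le_coe_of_forall_lt_coe fun u hu => (excessTime_lt_coe_iff_drawup hω).2 ⟨t, hu, ?_⟩
  exact hc.trans_le ((τU_eq_coe_iff hω).1 ht.symm).1

lemma approachTime_le_τU : approachTime b z (fun s => X s ω) ≤ τU X z b ω :=
  iSup_le fun n => excessTime_le_τU hω (by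
    have : (0 : ℝ) < 1 / (n + 1) := by positivity
    linarith)

/-- If the path does not jump down at the end of the approach, the drawup reaches `b` there. -/
lemma τU_eq_approachTime
    (hjump : ∀ t : ℝ≥0, (∀ n : ℕ, excessTime (b - 1 / (n + 1)) z (fun s => X s ω) < t) →
      ⨆ n : ℕ, excessTime (b - 1 / (n + 1)) z (fun s => X s ω) = t →
      ∀ ε > 0, ∃ᶠ n : ℕ in atTop,
        X ((excessTime (b - 1 / (n + 1)) z (fun s => X s ω)).untopD 0) ω - ε ≤ X t ω) :
    τU X z b ω = approachTime b z (fun s => X s ω) := by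
  refine le_antisymm ?_ (approachTime_le_τU hω)
  by_cases h : approachTime b z (fun s => X s ω) = ⊤
  · rw [h]; exact le_top
  obtain ⟨t, ht⟩ := WithTop.ne_top_iff_exists.1 h
  have hle : ∀ n : ℕ, excessTime (b - 1 / (n + 1)) z (fun s => X s ω) ≤ t := fun n => by
    rw [ht]; exact le_iSup (fun n : ℕ => excessTime (b - 1 / (n + 1)) z fun s => X s ω) n
  rw [← ht]
  refine timeAbove_le (le_of_forall_pos_lt_add fun ε hε => ?_)
  by_cases hex : ∃ n : ℕ, excessTime (b - 1 / (n + 1)) z (fun s => X s ω) = t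
  · obtain ⟨n, hn⟩ := hex
    obtain ⟨m, hm⟩ := exists_nat_one_div_lt hε
    have heq : excessTime (b - 1 / ((max m n : ℕ) + 1)) z (fun s => X s ω) = t :=
      le_antisymm (hle _) (hn ▸ excessTime_seq_mono b z _ (le_max_right m n))
    have h1 := le_drawup_of_excessTime_eq hω heq
    have h2 : (1 : ℝ) / ((max m n : ℕ) + 1) ≤ 1 / (m + 1) :=
      one_div_le_one_div_of_le (by positivity) (by
        have : (m : ℝ) ≤ (max m n : ℕ) := Nat.cast_le.2 (le_max_left m n)
        linarith)
    linarith
  · push Not at hex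
    have hlt := fun n => lt_of_le_of_ne (hle n) (hex n)
    obtain ⟨m, hm⟩ := exists_nat_one_div_lt (half_pos hε)
    obtain ⟨n, hX, hn⟩ := ((hjump t hlt ht.symm (ε / 2) (half_pos hε)).and_eventually
      (eventually_ge_atTop m)).exists
    obtain ⟨u, hu⟩ := WithTop.ne_top_iff_exists.1 (hlt n).ne_top
    have h1 := le_drawup_of_excessTime_eq hω hu.symm
    rw [← hu, WithTop.untopD_coe] at hX
    have h3 := drawup_add_le hω z (WithTop.coe_le_coe.1 (hu ▸ hle n))
    have h2 : (1 : ℝ) / (n + 1) ≤ 1 / (m + 1) :=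
      one_div_le_one_div_of_le (by positivity) (by
        have : (m : ℝ) ≤ n := Nat.cast_le.2 hn
        linarith)
    linarith

end Path

/-! ### Quasi-left-continuity -/

section QuasiLeft

variable {Ω : Type*} [MeasurableSpace Ω] {X : ℝ≥0 → Ω → ℝ} {P : Measure Ω}

/-- The paths with a value below `-ε` at some point of the dense set before time `h`. -/
def dropSet (ε : ℝ) (h : ℝ≥0) : Set (ℝ≥0 → ℝ) :=
  {f | ∃ j, denseSeq ℝ≥0 j < h ∧ f (denseSeq ℝ≥0 j) < -ε}

lemma measurableSet_dropSet (ε : ℝ) (h : ℝ≥0) : MeasurableSet (dropSet ε h) := by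
  have : dropSet ε h = ⋃ j, ⋃ (_ : denseSeq ℝ≥0 j < h),
      {f : ℝ≥0 → ℝ | f (denseSeq ℝ≥0 j) < -ε} := by
    ext f; simp [dropSet]
  rw [this]
  exact MeasurableSet.iUnion fun j => MeasurableSet.iUnion fun _ =>
    measurableSet_lt (measurable_pi_apply _) measurable_const

/-- Right-continuity at time `0` makes early drops improbable. -/
lemma exists_measure_dropSet_le [IsProbabilityMeasure P] (hX : ∀ t, Measurable (X t))
    (hreg : ∀ ω, IsRegularPath fun t => X t ω) {ε : ℝ} (hε : 0 < ε) {δ : ℝ≥0∞} (hδ : 0 < δ) :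
    ∃ h > 0, P {ω | (fun t => X t ω) ∈ dropSet ε h} ≤ δ := by
  set s : ℕ → Set Ω := fun m => {ω | (fun t => X t ω) ∈ dropSet ε (1 / (m + 1))} with hs
  have hmeas : ∀ m, MeasurableSet (s m) := fun m =>
    measurableSet_dropSet ε _ |>.preimage (measurable_pi_lambda _ hX)
  have hanti : Antitone s := fun m n hmn ω ⟨j, hj, h⟩ =>
    ⟨j, hj.trans_le (one_div_le_one_div_of_le (by positivity) (by gcongr)), h⟩
  have hempty : ⋂ m, s m = ∅ := by
    refine eq_empty_of_forall_notMem fun ω hω => ?_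
    obtain ⟨u, hu, h⟩ := exists_Ico_forall_of_continuousWithinAt ((hreg ω).right_continuous 0)
      (p := fun x => -ε < x) (eventually_gt_nhds (by rw [(hreg ω).zero]; linarith))
    obtain ⟨m, hm⟩ := exists_nat_one_div_lt hu
    obtain ⟨j, hj, hX⟩ := mem_iInter.1 hω m
    exact lt_asymm (h _ zero_le (hj.trans hm)) hX
  have hlim := tendsto_measure_iInter_atTop (μ := P) (fun m => (hmeas m).nullMeasurableSet) hanti
    ⟨0, measure_ne_top _ _⟩
  rw [hempty, measure_empty] at hlim
  obtain ⟨m, hm⟩ := (hlim.eventually_lt_const hδ).exists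
  exact ⟨1 / (m + 1), by positivity, hm.le⟩

lemma discount_zero_of_ne_top {τ : WithTop ℝ≥0} (h : τ ≠ ⊤) : discount 0 τ = 1 := by
  obtain ⟨t, rfl⟩ := WithTop.ne_top_iff_exists.1 h
  rw [discount_coe]; simp

/-- Quasi-left-continuity: the process does not jump down at a finite time that is the strict limit
of an increasing sequence of optional times. By the strong Markov property a drop of size `ε` within
a short time after the `n`-th time is improbable, uniformly in `n`, while a jump at the limit causes
such a drop for all large `n`. -/
theorem ae_frequently_le_of_isOptionalTime [IsProbabilityMeasure P]
    (hX : IsSpectrallyNegativeLevy X P) (hreg : ∀ ω, IsRegularPath fun t => X t ω)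
    {τ : ℕ → Ω → WithTop ℝ≥0} (hτ : ∀ n, IsOptionalTime X (τ n))
    (hmono : ∀ ω, Monotone fun n => τ n ω) :
    ∀ᵐ ω ∂P, ∀ t : ℝ≥0, (∀ n, τ n ω < t) → ⨆ n, τ n ω = t → ∀ ε > 0,
      ∃ᶠ n in atTop, X ((τ n ω).untopD 0) ω - ε ≤ X t ω := by
  suffices hk : ∀ k : ℕ, ∀ᵐ ω ∂P, ∀ t : ℝ≥0, (∀ n, τ n ω < t) → ⨆ n, τ n ω = t →
      ∃ᶠ n in atTop, X ((τ n ω).untopD 0) ω - 1 / (k + 1) ≤ X t ω by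
    filter_upwards [ae_all_iff.2 hk] with ω h t h1 h2 ε hε
    obtain ⟨k, hk⟩ := exists_nat_one_div_lt hε
    exact (h k t h1 h2).mono fun n hn => by linarith
  intro k
  set ε : ℝ := 1 / (k + 1) with hεdef
  have hε : 0 < ε := by positivity
  rw [ae_iff]
  refine nonpos_iff_eq_zero.1 (le_of_forall_gt fun δ hδ => ?_)
  obtain ⟨δ', hδ', hlt⟩ := exists_between hδ
  refine lt_of_le_of_lt ?_ hlt
  obtain ⟨h, hh, hP⟩ := exists_measure_dropSet_le (P := P) hX.measurable hreg hε hδ'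
  set E : ℕ → Set Ω := fun n =>
    {ω | τ n ω ≠ ⊤ ∧ (fun u => shift X (fun ω => (τ n ω).untopD 0) u ω) ∈ dropSet ε h} with hE
  have hPE : ∀ n, P (E n) ≤ δ' := fun n => by
    have hτm := (hτ n).measurable hX.measurable
    have hEm : MeasurableSet (E n) := by
      refine MeasurableSet.inter ?_ ?_
      · exact (measurableSet_singleton (⊤ : WithTop ℝ≥0)).compl.preimage hτm
      · exact (measurableSet_dropSet ε h).preimage
          (measurable_shift hX.measurable hreg (hτm.untopD 0))
    have hSM := lintegral_discount_mul_shift hX hreg (hτ n) le_rfl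
      (H := (dropSet ε h).indicator 1) (measurable_one.indicator (measurableSet_dropSet ε h))
    calc P (E n) = ∫⁻ ω, (E n).indicator 1 ω ∂P := (lintegral_indicator_one hEm).symm
      _ = ∫⁻ ω, ENNReal.ofReal (discount 0 (τ n ω)) * (dropSet ε h).indicator 1
          (fun u => shift X (fun ω => (τ n ω).untopD 0) u ω) ∂P := by
        refine lintegral_congr fun ω => ?_
        by_cases h1 : τ n ω = ⊤
        · rw [indicator_of_notMem (fun h => h.1 h1), h1, discount_top]; simp
        · rw [discount_zero_of_ne_top h1, ENNReal.ofReal_one, one_mul]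
          by_cases h2 : (fun u => shift X (fun ω => (τ n ω).untopD 0) u ω) ∈ dropSet ε h
          · rw [indicator_of_mem (show ω ∈ E n from ⟨h1, h2⟩), indicator_of_mem h2]; rfl
          · rw [indicator_of_notMem (fun h => h2 h.2), indicator_of_notMem h2]
      _ = _ := hSM
      _ ≤ 1 * P {ω | (fun t => X t ω) ∈ dropSet ε h} := by
        gcongr
        · calc _ ≤ ∫⁻ _, 1 ∂P := lintegral_mono fun ω =>
                ENNReal.ofReal_le_one.2 (discount_le_one le_rfl _)
            _ = 1 := by simp
        · exact le_of_eq (lintegral_indicator_one ((measurableSet_dropSet ε h).preimage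
            (measurable_pi_lambda (fun ω t => X t ω) hX.measurable)))
      _ ≤ δ' := by rw [one_mul]; exact hP
  calc _ ≤ P (⋃ N, ⋂ n ≥ N, E n) := measure_mono fun ω hω => ?_
    _ = ⨆ N, P (⋂ n ≥ N, E n) := Monotone.measure_iUnion fun M N hMN =>
        biInter_subset_biInter_left fun n hn => le_trans hMN hn
    _ ≤ δ' := iSup_le fun N => (measure_mono (biInter_subset_of_mem le_rfl)).trans (hPE N)
  rw [mem_ofPred_eq] at hω
  push Not at hω
  obtain ⟨t, hlt', hsup, hev⟩ := hω
  have hnear : ∀ᶠ n in atTop, (t : WithTop ℝ≥0) < τ n ω + h := by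
    by_cases hth : t < h
    · refine Eventually.of_forall fun n => lt_of_lt_of_le (WithTop.coe_lt_coe.2 hth) ?_
      exact le_add_self
    · have h1 : ((t - h : ℝ≥0) : WithTop ℝ≥0) < ⨆ n, τ n ω := by
        rw [hsup]
        exact WithTop.coe_lt_coe.2 (tsub_lt_self (hh.trans_le (not_lt.1 hth)) hh)
      obtain ⟨N, hN⟩ := lt_iSup_iff.1 h1
      filter_upwards [eventually_ge_atTop N] with n hn
      obtain ⟨u, hu⟩ := WithTop.ne_top_iff_exists.1 (hlt' n).ne_top
      have h2 : ((t - h : ℝ≥0) : WithTop ℝ≥0) < τ n ω := hN.trans_le (hmono ω hn)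
      rw [← hu] at h2 ⊢
      rw [← WithTop.coe_add]
      exact WithTop.coe_lt_coe.2 (tsub_lt_iff_right (not_lt.1 hth) |>.1 (WithTop.coe_lt_coe.1 h2))
  obtain ⟨N, hN⟩ := eventually_atTop.1 (hnear.and hev)
  refine mem_iUnion.2 ⟨N, mem_iInter₂.2 fun n hn => ⟨(hlt' n).ne_top, ?_⟩⟩
  obtain ⟨h1, h2⟩ := hN n hn
  have h3 := hlt' n
  obtain ⟨u, hu⟩ := WithTop.ne_top_iff_exists.1 (hlt' n).ne_top
  rw [← hu] at h1 h2 h3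
  rw [← WithTop.coe_add] at h1
  have h1' : t < u + h := WithTop.coe_lt_coe.1 h1
  have h3' : u < t := WithTop.coe_lt_coe.1 h3
  rw [WithTop.untopD_coe] at h2
  have hsh := (isRegularPath_shift (hreg ω) fun ω => (τ n ω).untopD 0).right_continuous (t - u)
  obtain ⟨j, -, hj, hjX⟩ := exists_denseSeq_of_right_continuous hsh (u := h)
    (p := fun x => x < -ε) (eventually_lt_nhds (by
      simp only [shift]
      rw [← hu, WithTop.untopD_coe, add_tsub_cancel_of_le h3'.le]
      linarith)) (tsub_lt_iff_left h3'.le |>.2 h1')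
  exact ⟨j, hj, hjX⟩

/-- Almost surely the drawup reaches `b` as soon as it has approached `b`. -/
theorem ae_τU_eq_approachTime [IsProbabilityMeasure P]
    (hX : IsSpectrallyNegativeLevy X P) (hreg : ∀ ω, IsRegularPath fun t => X t ω) (b z : ℝ) :
    ∀ᵐ ω ∂P, τU X z b ω = approachTime b z fun s => X s ω := by
  filter_upwards [ae_frequently_le_of_isOptionalTime hX hreg
    (τ := fun n ω => excessTime (b - 1 / (n + 1)) z fun s => X s ω)
    (fun n => isOptionalTime_excessTime X _ z) (fun ω => excessTime_seq_mono b z _)] with ω h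
  exact τU_eq_approachTime (hreg ω) h

end QuasiLeft

/-! ### Restarting the drawup at the drawdown time -/

section Restart

variable {Ω : Type*} {X : ℝ≥0 → Ω → ℝ} {ω : Ω} {a b c y z : ℝ}

lemma eq_of_forall_lt_coe_iff {x x' : WithTop ℝ≥0} (h : ∀ u : ℝ≥0, x < u ↔ x' < u) : x = x' := by
  have key : ∀ {x x' : WithTop ℝ≥0}, (∀ u : ℝ≥0, x < u ↔ x' < u) → x ≤ x' := fun {x x'} h => by
    induction x' using WithTop.recTopCoe with
    | top => exact le_top
    | coe t => exact le_coe_of_forall_lt_coe fun u hu => (h u).2 (WithTop.coe_lt_coe.2 hu)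
  exact le_antisymm (key h) (key fun u => (h u).symm)

variable (hω : IsRegularPath fun t => X t ω) {T : Ω → ℝ≥0}
  (hmin : ∀ s ≤ T ω, X (T ω) ω ≤ X s ω) (hz : X (T ω) ω ≤ -z)
include hω hmin hz

lemma excessTime_eq_add_shift (hT : (T ω : WithTop ℝ≥0) < excessTime c z fun s => X s ω) :
    excessTime c z (fun s => X s ω) = T ω + excessTime c 0 (fun s => shift X T s ω) := by
  have hsh := isRegularPath_shift hω T
  have hle : ∀ s ≤ T ω, drawup X z s ω ≤ c := fun s hs => by
    by_contra! hn
    obtain ⟨u, hu, hu'⟩ := exists_between hT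
    obtain ⟨v, rfl⟩ := WithTop.ne_top_iff_exists.1 hu'.ne_top
    exact lt_asymm hu' ((excessTime_lt_coe_iff_drawup hω).2
      ⟨s, hs.trans_lt (WithTop.coe_lt_coe.1 hu), hn⟩)
  refine eq_of_forall_lt_coe_iff fun u => ?_
  rw [excessTime_lt_coe_iff_drawup hω]
  constructor
  · rintro ⟨s, hs, hc⟩
    have hTs : T ω < s := by
      by_contra! hn
      exact absurd hc (not_lt.2 (hle s hn))
    obtain ⟨w, rfl⟩ := exists_add_of_le hTs.le
    rw [drawup_add_eq_drawup_shift hω hmin hz] at hc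
    have h1 : excessTime c 0 (fun s => shift X T s ω) < ((u - T ω : ℝ≥0) : WithTop ℝ≥0) :=
      (excessTime_lt_coe_iff_drawup hsh).2 ⟨w, lt_tsub_iff_left.2 hs, hc⟩
    obtain ⟨v, hv⟩ := WithTop.ne_top_iff_exists.1 h1.ne_top
    rw [← hv] at h1 ⊢
    rw [← WithTop.coe_add]
    exact WithTop.coe_lt_coe.2 (lt_tsub_iff_left.1 (WithTop.coe_lt_coe.1 h1))
  · intro h
    have hne : excessTime c 0 (fun s => shift X T s ω) ≠ ⊤ := fun htop => by
      rw [htop, WithTop.add_top] at h; exact absurd h not_top_lt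
    obtain ⟨v, hv⟩ := WithTop.ne_top_iff_exists.1 hne
    rw [← hv, ← WithTop.coe_add] at h
    have h' := WithTop.coe_lt_coe.1 h
    obtain ⟨w, hw, hc⟩ := (excessTime_lt_coe_iff_drawup hsh (c := c) (z := 0)
      (t := u - T ω)).1 (hv ▸ WithTop.coe_lt_coe.2 (lt_tsub_iff_left.2 h'))
    rw [← drawup_add_eq_drawup_shift hω hmin hz] at hc
    exact ⟨_, lt_tsub_iff_left.1 hw, hc⟩

/-- The time at which the drawup reaches `b` is the sum of a time `T` at which the path is at its
running minimum and of the corresponding time for the restarted process. -/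
lemma approachTime_eq_add_shift (hb : 0 < b)
    (hU : τU X z b ω = approachTime b z fun s => X s ω) (hT : T ω ≤ τU X z b ω) :
    approachTime b z (fun s => X s ω) = T ω + approachTime b 0 (fun s => shift X T s ω) := by
  have hlt : (T ω : WithTop ℝ≥0) < approachTime b z fun s => X s ω := by
    rw [← hU]
    refine lt_of_le_of_ne hT fun h => ?_
    have h1 := ((τU_eq_coe_iff hω).1 h.symm).1
    have h2 : drawup X z (T ω) ω = 0 := by
      rw [drawup, min_eq_left ((runMin_le hω le_rfl).trans hz)]
      obtain ⟨s, hs, hseq⟩ := exists_eq_runMin hω (T ω)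
      linarith [hmin s hs, runMin_le hω (le_refl (T ω))]
    linarith
  obtain ⟨N, hN⟩ := lt_iSup_iff.1 hlt
  have hge : ∀ n, ∃ m ≥ n, (T ω : WithTop ℝ≥0) < excessTime (b - 1 / ((m : ℕ) + 1)) z
      fun s => X s ω := fun n =>
    ⟨max n N, le_max_left _ _, hN.trans_le (excessTime_seq_mono b z _ (le_max_right n N))⟩
  refine le_antisymm (iSup_le fun n => ?_) ?_
  · obtain ⟨m, hnm, hm⟩ := hge n
    refine (excessTime_seq_mono b z _ hnm).trans ?_
    simp only
    rw [excessTime_eq_add_shift hω hmin hz hm]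
    gcongr
    exact le_iSup (fun n : ℕ => excessTime (b - 1 / (n + 1)) 0 fun s => shift X T s ω) m
  · by_cases htop : approachTime b z (fun s => X s ω) = ⊤
    · rw [htop]; exact le_top
    obtain ⟨v, hv⟩ := WithTop.ne_top_iff_exists.1 htop
    rw [← hv] at hlt ⊢
    have hTv := WithTop.coe_lt_coe.1 hlt
    have hle : approachTime b 0 (fun s => shift X T s ω) ≤ ((v - T ω : ℝ≥0) : WithTop ℝ≥0) := by
      refine iSup_le fun n => ?_
      obtain ⟨m, hnm, hm⟩ := hge n
      refine (excessTime_seq_mono b 0 _ hnm).trans ?_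
      simp only
      have h1 : excessTime (b - 1 / ((m : ℕ) + 1)) z (fun s => X s ω) ≤ v := by
        rw [hv]; exact le_iSup (fun n : ℕ => excessTime (b - 1 / (n + 1)) z fun s => X s ω) m
      rw [excessTime_eq_add_shift hω hmin hz hm] at h1
      have hne : excessTime (b - 1 / ((m : ℕ) + 1)) 0 (fun s => shift X T s ω) ≠ ⊤ :=
        fun htop => by rw [htop, WithTop.add_top] at h1; exact absurd h1 (by
          rw [not_le]; exact WithTop.coe_lt_top v)
      obtain ⟨w, hw⟩ := WithTop.ne_top_iff_exists.1 hne
      rw [← hw] at h1 ⊢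
      rw [← WithTop.coe_add] at h1
      exact WithTop.coe_le_coe.2 (le_tsub_of_add_le_left (WithTop.coe_le_coe.1 h1))
    calc (T ω : WithTop ℝ≥0) + approachTime b 0 (fun s => shift X T s ω)
        ≤ T ω + ((v - T ω : ℝ≥0) : WithTop ℝ≥0) := by gcongr
      _ = v := by rw [← WithTop.coe_add, add_tsub_cancel_of_le hTv.le]

end Restart

/-! ### Expectations -/

section Expectation

variable {Ω : Type*} [MeasurableSpace Ω] {X : ℝ≥0 → Ω → ℝ} {P : Measure Ω} {a b p α r y z : ℝ}

lemma integrable_indicator_discount [IsProbabilityMeasure P] (hr : 0 ≤ r)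
    {τ : Ω → WithTop ℝ≥0} (hτ : AEMeasurable τ P) {A : Set Ω} (hA : NullMeasurableSet A P) :
    Integrable (A.indicator fun ω => discount r (τ ω)) P := by
  refine Integrable.of_bound
    (((measurable_discount r).comp_aemeasurable hτ).indicator₀ hA).aestronglyMeasurable 1
    (Eventually.of_forall fun ω => ?_)
  by_cases h : ω ∈ A
  · rw [indicator_of_mem h, Real.norm_of_nonneg (discount_nonneg r _)]
    exact discount_le_one hr _
  · rw [indicator_of_notMem h]; simp

lemma setIntegral_premium (hr : 0 < r) (p : ℝ) (m : WithTop ℝ≥0) :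
    ∫ t in {t : ℝ | 0 ≤ t ∧ (t.toNNReal : WithTop ℝ≥0) ≤ m}, Real.exp (-(r * t)) * p =
      p / r - p / r * discount r m := by
  have hint : ∀ c : ℝ, IntegrableOn (fun t => Real.exp (-(r * t)) * p) (Ioi c) := fun c => by
    have h := (integrableOn_exp_mul_Ioi (a := -r) (by linarith) c).mul_const p
    simp only [neg_mul] at h
    exact h
  have hval : ∀ c : ℝ, ∫ t in Ioi c, Real.exp (-(r * t)) * p = p / r * Real.exp (-(r * c)) :=
    fun c => by
      have := integral_exp_mul_Ioi (a := -r) (by linarith) c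
      simp only [neg_mul] at this
      rw [integral_mul_const, this]
      field_simp
  induction m using WithTop.recTopCoe with
  | top =>
    have : {t : ℝ | 0 ≤ t ∧ (t.toNNReal : WithTop ℝ≥0) ≤ ⊤} = Ici 0 := by
      ext t
      exact ⟨And.left, fun h => ⟨h, le_top⟩⟩
    rw [this, integral_Ici_eq_integral_Ioi, hval, discount_top]
    simp
  | coe v =>
    have : {t : ℝ | 0 ≤ t ∧ (t.toNNReal : WithTop ℝ≥0) ≤ v} = Icc 0 (v : ℝ) := by
      ext t
      simp only [mem_ofPred_eq, mem_Icc, WithTop.coe_le_coe]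
      exact and_congr_right fun _ => Real.toNNReal_le_iff_le_coe
    rw [this, integral_Icc_eq_integral_Ioc, discount_coe]
    have h1 := setIntegral_union (f := fun t => Real.exp (-(r * t)) * p) (μ := volume)
      (Ioc_disjoint_Ioi (le_refl (v : ℝ)) (a := 0)) measurableSet_Ioi
      ((hint 0).mono_set Ioc_subset_Ioi_self) (hint v)
    rw [Ioc_union_Ioi_eq_Ioi (NNReal.coe_nonneg v), hval, hval] at h1
    simp only [mul_zero, neg_zero, Real.exp_zero, mul_one] at h1
    linarith

omit [MeasurableSpace Ω] in
/-- The cash flow in terms of the discount factors at the drawdown and the drawup time. -/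
lemma payoff_eq (X : ℝ≥0 → Ω → ℝ) (hr : 0 < r) (ω : Ω) : payoff X r a b p α y z ω =
    (p / r + α) * {ω | τD X y a ω ≤ τU X z b ω}.indicator (fun ω => discount r (τD X y a ω)) ω +
      p / r * {ω | τU X z b ω < τD X y a ω}.indicator (fun ω => discount r (τU X z b ω)) ω
      - p / r := by
  rw [payoff, setIntegral_premium hr]
  rcases le_or_gt (τD X y a ω) (τU X z b ω) with h | h
  · rw [indicator_ofPred_of_pos (p := fun ω => τD X y a ω ≤ τU X z b ω) h,
      indicator_ofPred_of_pos (p := fun ω => τD X y a ω ≤ τU X z b ω) h,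
      indicator_ofPred_of_neg (p := fun ω => τU X z b ω < τD X y a ω) (not_lt.2 h), min_eq_left h]
    ring
  · rw [indicator_ofPred_of_neg (p := fun ω => τD X y a ω ≤ τU X z b ω) (not_le.2 h),
      indicator_ofPred_of_neg (p := fun ω => τD X y a ω ≤ τU X z b ω) (not_le.2 h),
      indicator_ofPred_of_pos (p := fun ω => τU X z b ω < τD X y a ω) h, min_eq_right h.le]
    ring

/-- A process that is not almost surely nonincreasing is positive with positive probability at some
time. -/
lemma exists_measure_pos (hX : IsSpectrallyNegativeLevy X P)
    (hreg : ∀ ω, IsRegularPath fun t => X t ω) : ∃ t, P {ω | 0 < X t ω} ≠ 0 := by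
  by_contra! hzero
  refine hX.not_nonincreasing ?_
  have h1 : ∀ i j, denseSeq ℝ≥0 i ≤ denseSeq ℝ≥0 j →
      ∀ᵐ ω ∂P, X (denseSeq ℝ≥0 j) ω ≤ X (denseSeq ℝ≥0 i) ω := fun i j hij => by
    obtain ⟨d, hd⟩ := exists_add_of_le hij
    have h2 := (hX.stationary_increments (denseSeq ℝ≥0 i) d).measure_mem_eq
      (measurableSet_Ioi (a := (0 : ℝ)))
    rw [← hd] at h2
    have h3 : (fun ω => X d ω - X 0 ω) ⁻¹' Ioi 0 = {ω | 0 < X d ω} := by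
      ext ω; simp [(hreg ω).zero]
    rw [h3, hzero d] at h2
    rw [ae_iff]
    convert h2 using 2
    ext ω; simp
  have h2 : ∀ᵐ ω ∂P, ∀ i j, denseSeq ℝ≥0 i ≤ denseSeq ℝ≥0 j →
      X (denseSeq ℝ≥0 j) ω ≤ X (denseSeq ℝ≥0 i) ω := by
    simp only [ae_all_iff]; exact h1
  filter_upwards [h2] with ω h s t hst
  by_contra! hlt
  have hne : s < t := lt_of_le_of_ne hst (by rintro rfl; exact lt_irrefl _ hlt)
  obtain ⟨mid, hm1, hm2⟩ := exists_between hlt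
  obtain ⟨i, -, hi, hXi⟩ := exists_denseSeq_of_right_continuous ((hreg ω).right_continuous s)
    (p := fun x => x < mid) (eventually_lt_nhds hm1) hne
  obtain ⟨j, hj, -, hXj⟩ := exists_denseSeq_of_right_continuous ((hreg ω).right_continuous t)
    (p := fun x => mid < x) (eventually_gt_nhds hm2) (lt_add_one t)
  exact absurd (h i j (hi.trans hj).le) (not_le.2 (hXi.trans hXj))

/-- A drawup of any size has positive probability: the path may have many consecutive independent
increments that exceed a fixed positive level. -/
lemma measure_τU_ne_top_pos [IsProbabilityMeasure P] (hX : IsSpectrallyNegativeLevy X P)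
    (hreg : ∀ ω, IsRegularPath fun t => X t ω) (b : ℝ) : 0 < P {ω | τU X 0 b ω ≠ ⊤} := by
  obtain ⟨t, ht⟩ := exists_measure_pos hX hreg
  obtain ⟨k, hk⟩ : ∃ k : ℕ, P {ω | 1 / ((k : ℝ) + 1) < X t ω} ≠ 0 := by
    by_contra! hall
    refine ht (measure_mono_null (fun ω hω => ?_) (measure_iUnion_null hall))
    obtain ⟨k, hk⟩ := exists_nat_one_div_lt (show 0 < X t ω from hω)
    exact mem_iUnion.2 ⟨k, hk⟩
  set ε : ℝ := 1 / ((k : ℝ) + 1)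
  have hε : 0 < ε := by positivity
  obtain ⟨N, hN⟩ := exists_nat_ge (b / ε)
  rw [div_le_iff₀ hε] at hN
  have hs : Monotone fun i : ℕ => (i : ℝ≥0) * t := fun i j hij => by
    simp only; gcongr
  have hind := (hX.indep_increments.nat hs).measure_inter_preimage_eq_mul (Finset.range N)
    (sets := fun _ => Ioi ε) (fun _ _ => measurableSet_Ioi)
  have hprob : ∀ i : ℕ, P ((fun ω => X (((i + 1 : ℕ) : ℝ≥0) * t) ω - X ((i : ℝ≥0) * t) ω) ⁻¹' Ioi ε)
      = P {ω | ε < X t ω} := fun i => by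
    have h2 := (hX.stationary_increments ((i : ℝ≥0) * t) t).measure_mem_eq
      (measurableSet_Ioi (a := ε))
    rw [show ((i + 1 : ℕ) : ℝ≥0) * t = i * t + t by push_cast; ring, h2]
    congr 1
    ext ω; simp [(hreg ω).zero]
  rw [Finset.prod_congr rfl fun i _ => hprob i, Finset.prod_const] at hind
  refine lt_of_lt_of_le ?_ (measure_mono (s := ⋂ i ∈ Finset.range N,
    (fun ω => X (((i + 1 : ℕ) : ℝ≥0) * t) ω - X ((i : ℝ≥0) * t) ω) ⁻¹' Ioi ε) fun ω hω => ?_)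
  · rw [hind]
    exact pos_iff_ne_zero.2 (pow_ne_zero _ hk)
  · have h1 : ∀ n ≤ N, n * ε ≤ X ((n : ℝ≥0) * t) ω := by
      intro n
      induction n with
      | zero => intro _; simp [(hreg ω).zero]
      | succ n ih =>
        intro hn
        have h2 := mem_iInter₂.1 hω n (Finset.mem_range.2 hn)
        simp only [mem_preimage, mem_Ioi] at h2
        have h3 := ih (by omega)
        push_cast at h2 ⊢
        linarith
    refine ne_top_of_le_ne_top WithTop.coe_ne_top (timeAbove_le (t := (N : ℝ≥0) * t) ?_)
    have := le_drawup (X := X) (ω := ω) 0 ((N : ℝ≥0) * t)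
    linarith [h1 N le_rfl]

variable [IsProbabilityMeasure P] (hX : IsSpectrallyNegativeLevy X P)
  (hreg : ∀ ω, IsRegularPath fun t => X t ω)
include hX hreg

omit [IsProbabilityMeasure P] in
lemma measurable_τD : Measurable (τD X y a) :=
  (isOptionalTime_τD hreg y a).measurable hX.measurable

lemma aemeasurable_τU : AEMeasurable (τU X z b) P :=
  ⟨fun ω => approachTime b z fun s => X s ω,
    (measurable_approachTime b z).comp (measurable_pi_lambda _ hX.measurable),
    ae_τU_eq_approachTime hX hreg b z⟩

lemma integrable_nu (hr : 0 ≤ r) : Integrable ({ω | τD X y a ω ≤ τU X z b ω}.indicator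
    fun ω => discount r (τD X y a ω)) P :=
  integrable_indicator_discount hr (measurable_τD hX hreg).aemeasurable
    (nullMeasurableSet_le (measurable_τD hX hreg).aemeasurable (aemeasurable_τU hX hreg))

lemma integrable_lam (hr : 0 ≤ r) : Integrable ({ω | τU X z b ω < τD X y a ω}.indicator
    fun ω => discount r (τU X z b ω)) P :=
  integrable_indicator_discount hr (aemeasurable_τU hX hreg)
    (nullMeasurableSet_lt (aemeasurable_τU hX hreg) (measurable_τD hX hreg).aemeasurable)

lemma discountOn_τU_pos (hr : 0 ≤ r) : 0 < discountOn P r (τU X 0 b) univ := by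
  rw [discountOn, integral_pos_iff_support_of_nonneg
    (fun ω => indicator_nonneg (fun _ _ => discount_nonneg r _) ω)
    (integrable_indicator_discount hr (aemeasurable_τU hX hreg) nullMeasurableSet_univ)]
  refine (measure_τU_ne_top_pos hX hreg b).trans_le (measure_mono fun ω hω => ?_)
  rw [Function.mem_support, indicator_of_mem (mem_univ ω)]
  obtain ⟨t, ht⟩ := WithTop.ne_top_iff_exists.1 (show τU X 0 b ω ≠ ⊤ from hω)
  rw [← ht, discount_coe]
  exact (Real.exp_pos _).ne'

lemma price_eq (hr : 0 < r) : Integrable (payoff X r a b p α y z) P ∧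
    price P X r a b p α y z =
      (p / r + α) * nu P X r a b y z + p / r * lam P X r a b y z - p / r := by
  have h1 := (integrable_nu hX hreg (a := a) (b := b) (y := y) (z := z) hr.le).const_mul (p / r + α)
  have h2 := (integrable_lam hX hreg (a := a) (b := b) (y := y) (z := z) hr.le).const_mul (p / r)
  constructor
  · exact ((h1.add h2).sub (integrable_const _)).congr
      (Eventually.of_forall fun ω => (payoff_eq X hr ω).symm)
  · have h3 := integral_sub (h1.add h2) (integrable_const (p / r))
    rw [integral_add' h1 h2, integral_const_mul, integral_const_mul, integral_const, probReal_univ,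
      one_smul] at h3
    exact (integral_congr_ae (Eventually.of_forall fun ω => payoff_eq X hr ω)).trans h3

lemma lam_eq (hr : 0 ≤ r) (hb : 0 < b) (hab : b < a) : lam P X r a b y z =
    discountOn P r (timeAbove X (b - z))
      {ω | timeAbove X (b - z) ω < timeBelow X (max (y - a) (-z)) ω} +
    discountOn P r (τU X z b)
      {ω | max (stoppedValue (runMax X) (τU X z b) ω) y
          - stoppedValue (runMin X) (τU X z b) ω < a ∧
          stoppedValue (runMin X) (τU X z b) ω ≤ -z} := by
  have hpath := fun ω => indicator_discount_τU (hreg ω) (y := y) (z := z) r hb hab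
  -- on `{τU < ∞}` the running minimum at `τU` is at most `-z` iff `-z` has been passed before `τU`
  have hmeas : NullMeasurableSet {ω | τU X z b ω < τD X y a ω ∧
      timeAbove (fun t ω => -X t ω) z ω ≤ τU X z b ω} P :=
    (nullMeasurableSet_lt (aemeasurable_τU hX hreg)
      (measurable_τD hX hreg).aemeasurable).inter
    (nullMeasurableSet_le ((isOptionalTime_timeAbove_neg hreg z).measurable
      hX.measurable).aemeasurable (aemeasurable_τU hX hreg))
  have hint2 : Integrable ({ω | max (stoppedValue (runMax X) (τU X z b) ω) y
          - stoppedValue (runMin X) (τU X z b) ω < a ∧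
          stoppedValue (runMin X) (τU X z b) ω ≤ -z}.indicator
        fun ω => discount r (τU X z b ω)) P := by
    refine (integrable_indicator_discount hr
      (aemeasurable_τU hX hreg (b := b) (z := z)) hmeas).congr (Eventually.of_forall fun ω => ?_)
    by_cases h3 : τU X z b ω = ⊤
    · simp [indicator, h3, discount_top]
    obtain ⟨t, ht⟩ := WithTop.ne_top_iff_exists.1 h3
    refine indicator_ofPred_congr ?_
    rw [stoppedValue_of_eq_coe ht.symm, stoppedValue_of_eq_coe ht.symm, ← ht,
      timeAbove_le_iff fun t => ((hreg ω).right_continuous t).neg]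
    have hiff : (∃ s ≤ t, z ≤ -X s ω) ↔ runMin X t ω ≤ -z := by
      constructor
      · rintro ⟨s, hs, h⟩
        exact (runMin_le (hreg ω) hs).trans (by linarith)
      · intro h
        obtain ⟨s, hs, hseq⟩ := exists_eq_runMin (hreg ω) t
        exact ⟨s, hs, by linarith⟩
    rw [hiff]
    refine and_congr_left fun hm => ?_
    rw [← not_le, τD_le_iff_of_τU_eq (hreg ω) hb hab ht.symm hm, not_le]
  have hint1 : Integrable ({ω | timeAbove X (b - z) ω < timeBelow X (max (y - a) (-z)) ω}.indicator
        fun ω => discount r (timeAbove X (b - z) ω)) P := by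
    refine ((integrable_lam hX hreg (a := a) (b := b) (y := y) (z := z) hr).sub hint2).congr
      (Eventually.of_forall fun ω => ?_)
    rw [Pi.sub_apply, hpath ω, add_sub_cancel_right]
  rw [lam, discountOn, discountOn, discountOn, ← integral_add hint1 hint2]
  exact integral_congr_ae (Eventually.of_forall hpath)

/-- By the strong Markov property at the drawdown time, the drawup time on `τD ≤ τU` is the drawdown
time plus an independent copy of the drawup time from `0`. -/
lemma discountOn_τU_eq_nu_mul (hr : 0 ≤ r) (hb : 0 < b) (hab : b < a) (hyz : y + z < a) :
    discountOn P r (τU X z b) {ω | τD X y a ω ≤ τU X z b ω} =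
      nu P X r a b y z * discountOn P r (τU X 0 b) univ := by
  classical
  set σ : Ω → WithTop ℝ≥0 := fun ω => approachTime b z fun s => X s ω with hσ
  -- `τD ≤ τU` is replaced by `τD ≤ σ`, almost surely the same event, to obtain an optional time
  set T : Ω → WithTop ℝ≥0 := fun ω => if τD X y a ω ≤ σ ω then τD X y a ω else ⊤ with hTdef
  have hTopt : IsOptionalTime X T := by
    intro t
    have : {ω | T ω < t} = {ω | τD X y a ω < t} \ ⋃ k, ⋃ (_ : denseSeq ℝ≥0 k < t),
        {ω | σ ω < denseSeq ℝ≥0 k} \ {ω | τD X y a ω < denseSeq ℝ≥0 k} := by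
      ext ω
      simp only [mem_ofPred_eq, Set.mem_sdiff, mem_iUnion, not_exists, not_and, not_not, hTdef]
      split_ifs with h
      · exact ⟨fun h1 => ⟨h1, fun k _ hk => h.trans_lt hk⟩, And.left⟩
      · refine ⟨fun h1 => absurd h1 not_top_lt, fun ⟨h1, h2⟩ => absurd h ?_⟩
        rw [not_not]
        by_contra! hlt
        obtain ⟨d, hd⟩ := WithTop.ne_top_iff_exists.1 h1.ne_top
        obtain ⟨s, hs⟩ := WithTop.ne_top_iff_exists.1 hlt.ne_top
        rw [← hd] at h1 hlt h2
        rw [← hs] at hlt h2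
        obtain ⟨k, hk1, hk2⟩ := exists_denseSeq_between (WithTop.coe_lt_coe.1 hlt)
        have h3 := h2 k (hk2.trans (WithTop.coe_lt_coe.1 h1)) (WithTop.coe_lt_coe.2 hk1)
        exact lt_asymm hk2 (WithTop.coe_lt_coe.1 h3)
    rw [this]
    refine (isOptionalTime_τD hreg y a t).diff (MeasurableSet.iUnion fun k =>
      MeasurableSet.iUnion fun hk => ?_)
    exact past_mono X hk.le _ ((isOptionalTime_approachTime X b z _).diff
      (isOptionalTime_τD hreg y a _))
  have hTm := hTopt.measurable hX.measurable
  have hpath : Measurable fun ω t => X t ω := measurable_pi_lambda _ hX.measurable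
  have hsh := measurable_shift hX.measurable hreg (hTm.untopD 0)
  have hda := (measurable_discount r).comp (measurable_approachTime b 0)
  have hdT := (measurable_discount r).comp hTm
  have hSM := lintegral_discount_mul_shift hX hreg hTopt hr
    (H := fun f => ENNReal.ofReal (discount r (approachTime b 0 f))) hda.ennreal_ofReal
  have e1 : discountOn P r (τU X z b) {ω | τD X y a ω ≤ τU X z b ω} =
      ∫ ω, discount r (T ω) *
        discount r (approachTime b 0 fun u => shift X (fun ω => (T ω).untopD 0) u ω) ∂P := by
    refine integral_congr_ae ?_
    filter_upwards [ae_τU_eq_approachTime hX hreg b z] with ω hU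
    by_cases h : τD X y a ω ≤ τU X z b ω
    · rw [indicator_ofPred_of_pos (p := fun ω => τD X y a ω ≤ τU X z b ω) h]
      have hTω : T ω = τD X y a ω := if_pos (h.trans_eq hU)
      by_cases htop : τD X y a ω = ⊤
      · rw [htop, top_le_iff] at h
        rw [hTω, htop, discount_top, zero_mul, h, discount_top]
      obtain ⟨t, ht⟩ := WithTop.ne_top_iff_exists.1 htop
      have hTt : (T ω).untopD 0 = t := by rw [hTω, ← ht, WithTop.untopD_coe]
      have hmin := isMin_of_τD_le_τU (hreg ω) hb hab hyz ht.symm (ht ▸ h)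
      rw [hU, approachTime_eq_add_shift (hreg ω) (T := fun ω => (T ω).untopD 0)
        (by simp only [hTt]; exact hmin.1) (by simp only [hTt]; exact hmin.2) hb hU
        (by simp only [hTt]; exact ht ▸ h), discount_add]
      simp only [hTt]
      rw [hTω, ht]
    · rw [indicator_ofPred_of_neg (p := fun ω => τD X y a ω ≤ τU X z b ω) h]
      have hTω : T ω = ⊤ := if_neg fun h1 => h (h1.trans_eq hU.symm)
      rw [hTω, discount_top, zero_mul]
  have e2 : nu P X r a b y z = ∫ ω, discount r (T ω) ∂P := by
    refine integral_congr_ae ?_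
    filter_upwards [ae_τU_eq_approachTime hX hreg b z] with ω hU
    by_cases h : τD X y a ω ≤ τU X z b ω
    · rw [indicator_ofPred_of_pos (p := fun ω => τD X y a ω ≤ τU X z b ω) h,
        show T ω = τD X y a ω from if_pos (h.trans_eq hU)]
    · rw [indicator_ofPred_of_neg (p := fun ω => τD X y a ω ≤ τU X z b ω) h,
        show T ω = ⊤ from if_neg fun h1 => h (h1.trans_eq hU.symm), discount_top]
  have e3 : discountOn P r (τU X 0 b) univ =
      ∫ ω, discount r (approachTime b 0 fun s => X s ω) ∂P := by
    refine integral_congr_ae ?_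
    filter_upwards [ae_τU_eq_approachTime hX hreg b 0] with ω hU
    rw [indicator_of_mem (mem_univ ω), hU]
  rw [e1, e2, e3, integral_eq_lintegral_of_nonneg_ae, integral_eq_lintegral_of_nonneg_ae,
    integral_eq_lintegral_of_nonneg_ae, ← ENNReal.toReal_mul, ← hSM]
  · simp only [ENNReal.ofReal_mul (discount_nonneg r _)]
  · exact Eventually.of_forall fun ω => discount_nonneg r _
  · exact (hda.comp hpath).aestronglyMeasurable
  · exact Eventually.of_forall fun ω => discount_nonneg r _
  · exact hdT.aestronglyMeasurable
  · exact Eventually.of_forall fun ω => mul_nonneg (discount_nonneg r _) (discount_nonneg r _)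
  · exact (hdT.mul (hda.comp hsh)).aestronglyMeasurable

lemma nu_eq (hr : 0 ≤ r) (hb : 0 < b) (hab : b < a) (hy : 0 ≤ y) (hyz : y < a ∨ z < b) :
    nu P X r a b y z
      = (if a ≤ y + z then
          discountOn P r (timeBelow X (y - a))
            {ω | timeBelow X (y - a) ω < timeAbove X (b - z) ω}
        else 0)
      + (if y + z < a then
          discountOn P r (τU X z b)
            {ω | a ≤ max (stoppedValue (runMax X) (τU X z b) ω) y
                    - stoppedValue (runMin X) (τU X z b) ω ∧
                stoppedValue (runMin X) (τU X z b) ω ≤ -z ∧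
                stoppedValue (runMax X) (τU X z b) ω ≤ b - z}
            / discountOn P r (τU X 0 b) univ
        else 0) := by
  rcases le_or_gt a (y + z) with h | h
  · rw [if_pos h, if_neg (not_lt.2 h), add_zero]
    exact integral_congr_ae (Eventually.of_forall fun ω =>
      indicator_discount_τD_of_le (hreg ω) r hab hy hyz h)
  · rw [if_neg (not_le.2 h), if_pos h, zero_add,
      eq_div_iff (discountOn_τU_pos hX hreg hr).ne', ← discountOn_τU_eq_nu_mul hX hreg hr hb hab h]
    exact integral_congr_ae (Eventually.of_forall fun ω =>
      (indicator_discount_τU_of_lt (hreg ω) r hb hab h).symm)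

end Expectation

/-! ### Reduction to a process all of whose paths are regular -/

section Modification

variable {Ω : Type*} [MeasurableSpace Ω] {X Y : ℝ≥0 → Ω → ℝ} {P : Measure Ω}

lemma isRegularPath_zero : IsRegularPath fun _ => 0 :=
  ⟨rfl, fun _ => continuousWithinAt_const, fun _ => ⟨0, tendsto_const_nhds, le_rfl⟩⟩

lemma IsSpectrallyNegativeLevy.ae_isRegularPath (hX : IsSpectrallyNegativeLevy X P) :
    ∀ᵐ ω ∂P, IsRegularPath fun t => X t ω := by
  filter_upwards [hX.start_zero, hX.right_continuous, hX.left_limits_no_positive_jumps]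
    with ω h1 h2 h3
  exact ⟨h1, h2, h3⟩

lemma IsSpectrallyNegativeLevy.congr (hX : IsSpectrallyNegativeLevy X P)
    (hY : ∀ t, Measurable (Y t)) (h : ∀ᵐ ω ∂P, (fun t => X t ω) = fun t => Y t ω) :
    IsSpectrallyNegativeLevy Y P := by
  have hinc : ∀ s t, (fun ω => X t ω - X s ω) =ᵐ[P] fun ω => Y t ω - Y s ω := fun s t => by
    filter_upwards [h] with ω hω
    rw [congrFun hω t, congrFun hω s]
  have hid : ∀ s t, IdentDistrib (fun ω => X t ω - X s ω) (fun ω => Y t ω - Y s ω) P P :=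
    fun s t => IdentDistrib.of_ae_eq ((hX.measurable t).sub (hX.measurable s)).aemeasurable
      (hinc s t)
  refine ⟨hY, ?_, fun n t ht => (hX.indep_increments n t ht).congr fun i => hinc _ _,
    fun s t => ((hid s (s + t)).symm.trans (hX.stationary_increments s t)).trans (hid 0 t),
    ?_, ?_, fun hmono => hX.not_nonincreasing ?_⟩
  · filter_upwards [h, hX.start_zero] with ω hω h0
    rwa [← congrFun hω 0]
  · filter_upwards [h, hX.right_continuous] with ω hω h0
    rwa [← hω]
  · filter_upwards [h, hX.left_limits_no_positive_jumps] with ω hω h0 t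
    rw [← hω, ← congrFun hω t]
    exact h0 t
  · filter_upwards [h, hmono] with ω hω h0 s t hst
    rw [congrFun hω t, congrFun hω s]
    exact h0 s t hst

lemma IsSpectrallyNegativeLevy.exists_regular_modification (hX : IsSpectrallyNegativeLevy X P) :
    ∃ Y : ℝ≥0 → Ω → ℝ, IsSpectrallyNegativeLevy Y P ∧ (∀ ω, IsRegularPath fun t => Y t ω) ∧
      ∀ᵐ ω ∂P, (fun t => X t ω) = fun t => Y t ω := by
  classical
  obtain ⟨N, hsub, hN, hN0⟩ := exists_measurable_superset_of_null (ae_iff.1 hX.ae_isRegularPath)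
  have hmod : ∀ᵐ ω ∂P, (fun t => X t ω) = fun t => Nᶜ.indicator (X t) ω := by
    filter_upwards [measure_eq_zero_iff_ae_notMem.1 hN0] with ω hω
    funext t
    rw [indicator_of_mem (show ω ∈ Nᶜ from hω)]
  refine ⟨fun t => Nᶜ.indicator (X t),
    hX.congr (fun t => (hX.measurable t).indicator hN.compl) hmod, fun ω => ?_, hmod⟩
  by_cases hω : ω ∈ N
  · have : (fun t => Nᶜ.indicator (X t) ω) = fun _ => 0 :=
      funext fun t => indicator_of_notMem (show ¬ ω ∈ Nᶜ from not_not.2 hω) _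
    rw [this]
    exact isRegularPath_zero
  · have : (fun t => Nᶜ.indicator (X t) ω) = fun t => X t ω :=
      funext fun t => indicator_of_mem (show ω ∈ Nᶜ from hω) _
    rw [this]
    by_contra hreg
    exact hω (hsub hreg)

/-- The discounted probability of an event depends on the paths only up to a null set:
the time is a function `τ` of the path, and the event is given by a condition `A` on the path. -/
lemma discountOn_congr (h : ∀ᵐ ω ∂P, (fun t => X t ω) = fun t => Y t ω) (r : ℝ)
    (τ : (ℝ≥0 → ℝ) → WithTop ℝ≥0) (A : (ℝ≥0 → ℝ) → Prop) :
    discountOn P r (fun ω => τ fun t => X t ω) {ω | A fun t => X t ω} =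
      discountOn P r (fun ω => τ fun t => Y t ω) {ω | A fun t => Y t ω} := by
  refine integral_congr_ae ?_
  filter_upwards [h] with ω hω
  by_cases hA : A fun t => X t ω
  · rw [indicator_ofPred_of_pos (p := fun ω => A fun t => X t ω) hA,
      indicator_ofPred_of_pos (p := fun ω => A fun t => Y t ω) (hω ▸ hA), hω]
  · rw [indicator_ofPred_of_neg (p := fun ω => A fun t => X t ω) hA,
      indicator_ofPred_of_neg (p := fun ω => A fun t => Y t ω) (hω ▸ hA)]

end Modification

end Drawdown

theorem mainTheorem6 {Ω : Type*} [MeasurableSpace Ω] (P : Measure Ω) [IsProbabilityMeasure P]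
    (X : ℝ≥0 → Ω → ℝ) (hX : Drawdown.IsSpectrallyNegativeLevy X P)
    (r a b p α y z : ℝ) (hr : 0 < r) (hb : 0 < b) (hab : b < a)
    (hy : 0 ≤ y) (hz : 0 ≤ z) (hyz : y < a ∨ z < b) :
    Integrable (Drawdown.payoff X r a b p α y z) P ∧
    Drawdown.price P X r a b p α y z
      = (p / r + α) * Drawdown.nu P X r a b y z + p / r * Drawdown.lam P X r a b y z - p / r ∧
    -- the normalising constant in the formula for `ν` is nonzero
    0 < Drawdown.discountOn P r (Drawdown.τU X 0 b) Set.univ ∧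
    Drawdown.nu P X r a b y z
      = (if a ≤ y + z then
          Drawdown.discountOn P r (Drawdown.timeBelow X (y - a))
            {ω | Drawdown.timeBelow X (y - a) ω < Drawdown.timeAbove X (b - z) ω}
        else 0)
      + (if y + z < a then
          Drawdown.discountOn P r (Drawdown.τU X z b)
            {ω | a ≤ max (stoppedValue (Drawdown.runMax X) (Drawdown.τU X z b) ω) y
                    - stoppedValue (Drawdown.runMin X) (Drawdown.τU X z b) ω ∧
                stoppedValue (Drawdown.runMin X) (Drawdown.τU X z b) ω ≤ -z ∧
                stoppedValue (Drawdown.runMax X) (Drawdown.τU X z b) ω ≤ b - z}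
            / Drawdown.discountOn P r (Drawdown.τU X 0 b) Set.univ
        else 0) ∧
    Drawdown.lam P X r a b y z
      = Drawdown.discountOn P r (Drawdown.timeAbove X (b - z))
          {ω | Drawdown.timeAbove X (b - z) ω < Drawdown.timeBelow X (max (y - a) (-z)) ω}
      + Drawdown.discountOn P r (Drawdown.τU X z b)
          {ω | max (stoppedValue (Drawdown.runMax X) (Drawdown.τU X z b) ω) y
                  - stoppedValue (Drawdown.runMin X) (Drawdown.τU X z b) ω < a ∧
              stoppedValue (Drawdown.runMin X) (Drawdown.τU X z b) ω ≤ -z} := by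
  obtain ⟨Y, hY, hreg, hXY⟩ := hX.exists_regular_modification
  -- every functional of the process is one of the coordinate process on path space
  let C : ℝ≥0 → (ℝ≥0 → ℝ) → ℝ := fun t f => f t
  have hpay : Drawdown.payoff X r a b p α y z =ᵐ[P] Drawdown.payoff Y r a b p α y z := by
    filter_upwards [hXY] with ω hω
    have hC : ∀ Z : ℝ≥0 → Ω → ℝ, Drawdown.payoff Z r a b p α y z ω =
        Drawdown.payoff C r a b p α y z fun t => Z t ω := fun Z => rfl
    rw [hC X, hC Y, hω]
  have hprice : Drawdown.price P X r a b p α y z = Drawdown.price P Y r a b p α y z :=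
    integral_congr_ae hpay
  have hnu : Drawdown.nu P X r a b y z = Drawdown.nu P Y r a b y z :=
    Drawdown.discountOn_congr hXY r (Drawdown.τD C y a)
      fun f => Drawdown.τD C y a f ≤ Drawdown.τU C z b f
  have hlam : Drawdown.lam P X r a b y z = Drawdown.lam P Y r a b y z :=
    Drawdown.discountOn_congr hXY r (Drawdown.τU C z b)
      fun f => Drawdown.τU C z b f < Drawdown.τD C y a f
  have hU : Drawdown.discountOn P r (Drawdown.τU X 0 b) Set.univ =
      Drawdown.discountOn P r (Drawdown.τU Y 0 b) Set.univ :=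
    Drawdown.discountOn_congr hXY r (Drawdown.τU C 0 b) fun _ => True
  have hbelow := Drawdown.discountOn_congr hXY r (Drawdown.timeBelow C (y - a))
    fun f => Drawdown.timeBelow C (y - a) f < Drawdown.timeAbove C (b - z) f
  have habove := Drawdown.discountOn_congr hXY r (Drawdown.timeAbove C (b - z))
    fun f => Drawdown.timeAbove C (b - z) f < Drawdown.timeBelow C (max (y - a) (-z)) f
  have hlarge := Drawdown.discountOn_congr hXY r (Drawdown.τU C z b) fun f =>
    a ≤ max (stoppedValue (Drawdown.runMax C) (Drawdown.τU C z b) f) y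
        - stoppedValue (Drawdown.runMin C) (Drawdown.τU C z b) f ∧
      stoppedValue (Drawdown.runMin C) (Drawdown.τU C z b) f ≤ -z ∧
      stoppedValue (Drawdown.runMax C) (Drawdown.τU C z b) f ≤ b - z
  have hsmall := Drawdown.discountOn_congr hXY r (Drawdown.τU C z b) fun f =>
    max (stoppedValue (Drawdown.runMax C) (Drawdown.τU C z b) f) y
        - stoppedValue (Drawdown.runMin C) (Drawdown.τU C z b) f < a ∧
      stoppedValue (Drawdown.runMin C) (Drawdown.τU C z b) f ≤ -z
  obtain ⟨hint, hval⟩ := Drawdown.price_eq hY hreg (a := a) (b := b) (p := p) (α := α) (y := y)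
    (z := z) hr
  have hnu' := Drawdown.nu_eq hY hreg hr.le hb hab hy hyz
  have hlam' := Drawdown.lam_eq hY hreg (y := y) (z := z) hr.le hb hab
  refine ⟨hint.congr hpay.symm, ?_, ?_, ?_, ?_⟩
  · rw [hprice, hnu, hlam, hval]
  · rw [hU]
    exact Drawdown.discountOn_τU_pos hY hreg hr.le
  · rw [hnu, hU, hnu']
    exact congrArg₂ (· + ·) (ite_congr rfl (fun _ => hbelow.symm) fun _ => rfl)
      (ite_congr rfl (fun _ => congrArg (· / _) hlarge.symm) fun _ => rfl)
  · rw [hlam, hlam']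
    exact congrArg₂ (· + ·) habove.symm hsmall.symm
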